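/- A degree sequence of length $n$ is $\boldsymbol d_n=(d_{n,i})_{i\in[n]}$ with integers $0\le d_{n,i}<n$ and $m_n=\sum_i d_{n,i}$ even; it is feasible if it is the degree sequence of a simple graph on $[n]$. Let $\boldsymbol d=(\boldsymbol d_n)_{n}$ be a sequence of degree sequences, put $n_{n,k}=|\{i\in[n]: d_{n,i}=k\}|$, and let $D_n$ be the degree distribution, $\Pr(D_n=k)=n_{n,k}/n$. Assume that there is a probability distribution $D$ on $\mathbb N_0$ such that (i) $\boldsymbol d_n$ is feasible for all $n$; (ii) $D_n\to D$ in distribution; (iii) $\mathbb E[D]$ and $\mathbb E[D^2]$ are finite, $\mathbb E[D_n]\to\mathbb E[D]$ and $\mathbb E[D_n^2]\to\mathbb E[D^2]$; (iv) if $\Pr(D=k)=0$ for some $k\in\mathbb N_0$, then $n_{n,k}=0$ for all $n$. Let $\nu=\mathbb E[D(D-1)]/\mathbb E[D]$, with $\nu=0$ if $\mathbb E[D]=0$ (in which case all degrees are zero). The configuration model $\mathbb{CM}_n(\boldsymbol d_n)$ is the random multigraph on $[n]$ obtained by attaching $d_{n,i}$ half-edges to each vertex $i$ and choosing a uniformly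 random perfect matching of the $m_n$ half-edges; each matched pair is an edge joining the vertices to which its two half-edges are attached. For $k\ge1$, let $X_{n,k}$ be the number of $k$-cycles in $\mathbb{CM}_n(\boldsymbol d_n)$, i.e. of sub-multigraphs that are cycles of length $k$, where parallel edges (and several loops at one vertex) are regarded as distinct edges; a $1$-cycle is a vertex with a loop and a $2$-cycle is a pair of vertices with two edges joining them. Then, for any finite collection of distinct integers $k_1,\dots,k_l\ge1$, the random vector $(X_{n,k_1},\dots,X_{n,k_l})$ converges in distribution, as $n\to\infty$, to a vector of independent Poisson variables with respective means $\nu^{k_i}/(2k_i)$. Moreover, $$\lim_{n\to\infty}\Pr\big(\mathbb{CM}_n(\boldsymbol d_n)\text{ is simple (has no loops and no multiple edges)}\big)=e^{-\nu/2-\nu^2/4}.$$ -/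

import Mathlib

open Filter MeasureTheory ProbabilityTheory

/-- A degree sequence of length `n`: non-negative integers `d i < n` with even sum. -/
structure DegreeSequence (n : ℕ) where
  deg : Fin n → ℕ
  deg_lt : ∀ i, deg i < n
  even_sum : Even (∑ i, deg i)

namespace DegreeSequence

variable {n : ℕ}

/-- `d` is feasible if it is the degree sequence of some simple graph with vertex set `Fin n`. -/
def IsFeasible (d : DegreeSequence n) : Prop :=
  ∃ (G : SimpleGraph (Fin n)) (_ : DecidableRel G.Adj), ∀ v, G.degree v = d.deg v

/-- The number of vertices of degree `k`. -/
def countDeg (d : DegreeSequence n) (k : ℕ) : ℕ :=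
  (Finset.univ.filter fun i => d.deg i = k).card

/-- The half-edges: `d.deg v` of them are incident to each vertex `v`. -/
abbrev HalfEdge (d : DegreeSequence n) : Type := Σ v : Fin n, Fin (d.deg v)

/-- The perfect matchings of the half-edges: sets of unordered pairs of distinct half-edges
such that every half-edge lies in exactly one pair. -/
def Configuration (d : DegreeSequence n) : Type :=
  {M : Finset (Sym2 d.HalfEdge) // (∀ e ∈ M, ¬ e.IsDiag) ∧ ∀ h, ∃! e, e ∈ M ∧ h ∈ e}

instance (d : DegreeSequence n) : Finite d.Configuration :=
  inferInstanceAs (Finite {M : Finset (Sym2 d.HalfEdge) //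
    (∀ e ∈ M, ¬ e.IsDiag) ∧ ∀ h, ∃! e, e ∈ M ∧ h ∈ e})

/-- Every set of configurations is an event. -/
instance (d : DegreeSequence n) : MeasurableSpace d.Configuration := ⊤

instance (d : DegreeSequence n) : DiscreteMeasurableSpace d.Configuration :=
  ⟨fun _ => trivial⟩

/-- Since the number of half-edges is even, there is at least one configuration. -/
instance (d : DegreeSequence n) : Nonempty d.Configuration := by
  classical
  obtain ⟨r, hr⟩ := d.even_sum
  have hcard : Fintype.card d.HalfEdge = Fintype.card (Fin r × Bool) := by
    simp [hr]; ring
  let φ : d.HalfEdge ≃ Fin r × Bool := Fintype.equivOfCardEq hcard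
  refine ⟨⟨Finset.univ.image fun i : Fin r => s(φ.symm (i, true), φ.symm (i, false)), ?_, ?_⟩⟩
  · simp
  · intro h
    refine ⟨s(φ.symm ((φ h).1, true), φ.symm ((φ h).1, false)), ⟨by simp, ?_⟩, ?_⟩
    · rw [Sym2.mem_iff]
      rcases hb : φ h with ⟨i, b⟩
      cases b
      · right; simp [Equiv.eq_symm_apply, hb]
      · left; simp [Equiv.eq_symm_apply, hb]
    · rintro e ⟨he, hmem⟩
      simp only [Finset.mem_image, Finset.mem_univ, true_and] at he
      obtain ⟨i, rfl⟩ := he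
      rw [Sym2.mem_iff] at hmem
      rcases hmem with rfl | rfl <;> simp

/-- The law of the configuration model: a uniformly random perfect matching of the half-edges. -/
noncomputable def configurationModel (d : DegreeSequence n) : Measure d.Configuration :=
  uniformOn Set.univ

instance (d : DegreeSequence n) : IsProbabilityMeasure d.configurationModel :=
  inferInstanceAs (IsProbabilityMeasure (uniformOn Set.univ))

/-- The underlying multigraph of a configuration, on the vertex set `Fin n`. Its edges are the
pairs of the matching; the ends of an edge are the vertices its two half-edges are incident to. -/
def Configuration.multigraph {d : DegreeSequence n} (M : d.Configuration) :
    Graph (Fin n) (Sym2 d.HalfEdge) where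
  vertexSet := Set.univ
  edgeSet := {e | e ∈ M.1}
  IsLink e u v := e ∈ M.1 ∧ e.map Sigma.fst = s(u, v)
  isLink_symm := fun _ _ => ⟨fun _ _ h => ⟨h.1, h.2.trans Sym2.eq_swap⟩⟩
  eq_or_eq_of_isLink_of_isLink := by
    rintro e x y v w ⟨_, h⟩ ⟨_, h'⟩
    rw [h] at h'
    rcases Sym2.eq_iff.1 h' with h | h
    · exact Or.inl h.1
    · exact Or.inr h.1
  edge_mem_iff_exists_isLink := by
    intro e
    constructor
    · intro he
      induction e with
      | h a b => exact ⟨a.1, b.1, he, rfl⟩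
    · rintro ⟨_, _, h, _⟩
      exact h
  left_mem_of_isLink := fun _ _ _ _ => trivial

end DegreeSequence

/-- The multigraph `G` is a cycle of length `k` (for `k ≥ 1`): distinct vertices
`v 0, …, v (k - 1)` and distinct edges `e 0, …, e (k - 1)`, and nothing else, with `e i` joining
`v i` to its cyclic successor. A `1`-cycle is a vertex with a loop, and a `2`-cycle is a pair of
vertices with two edges joining them. -/
def Graph.IsCycleOfLength {α β : Type*} (G : Graph α β) (k : ℕ) : Prop :=
  ∃ (v : Fin k → α) (e : Fin k → β), Function.Injective v ∧ Function.Injective e ∧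
    G.vertexSet = Set.range v ∧ G.edgeSet = Set.range e ∧
    ∀ i, G.IsLink (e i) (v i) (v (finRotate k i))

/-- The number of `k`-cycles in `G`, i.e. of sub-multigraphs of `G` that are cycles of
length `k`. -/
noncomputable def Graph.cycleCount {α β : Type*} (G : Graph α β) (k : ℕ) : ℕ :=
  {C : Graph α β | C ≤ G ∧ C.IsCycleOfLength k}.ncard

/-- The regularity assumption on a sequence of degree sequences, with limit degree
distribution `D`. The degree distribution `D_n` is the law of `(d n).deg` at a uniform vertex; it
makes sense for `n ≥ 1` only, which is why limits are taken along `n + 1`. -/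
structure HasLimitDegreeDistribution (d : (n : ℕ) → DegreeSequence n) (D : Measure ℕ)
    [IsProbabilityMeasure D] : Prop where
  feasible : ∀ n, (d n).IsFeasible
  tendsto_distribution : TendstoInDistribution (fun n => (d (n + 1)).deg) atTop id
    (fun n => uniformOn (Set.univ : Set (Fin (n + 1)))) D
  integrable_fst : Integrable (fun k : ℕ => (k : ℝ)) D
  tendsto_fst_moment : Tendsto
    (fun n => ∫ i, ((d (n + 1)).deg i : ℝ) ∂(uniformOn (Set.univ : Set (Fin (n + 1)))))
    atTop (nhds (∫ k, (k : ℝ) ∂D))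
  integrable_snd : Integrable (fun k : ℕ => (k : ℝ) ^ 2) D
  tendsto_snd_moment : Tendsto
    (fun n => ∫ i, ((d (n + 1)).deg i : ℝ) ^ 2 ∂(uniformOn (Set.univ : Set (Fin (n + 1)))))
    atTop (nhds (∫ k, (k : ℝ) ^ 2 ∂D))
  countDeg_eq_zero : ∀ k, D {k} = 0 → ∀ n, (d n).countDeg k = 0

/-- The parameter `ν = E[D (D - 1)] / E[D]`, which is `0` if `D = 0` almost surely. -/
noncomputable def nuParameter (D : Measure ℕ) : ℝ :=
  (∫ k, (k : ℝ) * ((k : ℝ) - 1) ∂D) / ∫ k, (k : ℝ) ∂D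

/-! The proof uses factorial moments, and counts cycles by their passages through vertices. A
passage (`Transit`) is an ordered pair of distinct half-edges at one vertex. There are S = ∑ d(d -
1) of them, and S/m → ν, where m is the number of half-edges. A k-cycle is a cyclic sequence of k
passages through distinct vertices, and it has 2k such representations (`card_fibre_links`). Given t
disjoint pairs, all of them are matched with probability 1/((m - 1)(m - 3)⋯(m - 2t + 1))
(`card_pairingsContaining_mul`). Almost all of the S^t families of t passages go through distinct
vertices. So the expected number of vertex-disjoint systems with r_i cycles of length k_i, each with
its representation, tends to ν^t, where t = ∑ r_i k_i.

Overlapping cycles are handled for each matching separately. A cycle is isolated if it is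
vertex-disjoint from all other cycles of the lengths considered. Distinct isolated cycles always
form a vertex-disjoint system. Conversely, a vertex-disjoint system consists of isolated cycles
unless another cycle meets and leaves it, and that cycle then contains an ear: a short walk outside
the system with both ends on it (`exists_isEar`). An ear with l passages requires l + 1 further
pairs but brings only l factors S; its two ends bring O(Δ²), where Δ is the maximal degree. Hence
the expected number of eared systems is O(Δ²/m). Convergence of the second moments forces Δ² = o(n)
(`tendsto_maxDeg_sq_div`), so this vanishes. The factorial moments of the isolated counts therefore
converge to ∏ (ν^k_i / (2k_i))^r_i, and with probability tending to 1 all cycles considered are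
isolated.

Bonferroni's inequalities turn the moments into point probabilities
(`tendsto_finAverage_of_tendsto_factorial_moments`), and on a countable space these give convergence
in distribution. Simplicity is the absence of 1-cycles and 2-cycles. If E[D] = 0, then m does not
tend to infinity, but all degrees vanish and the claim is immediate. -/

section Pairing

/-! ### Perfect matchings that contain prescribed pairs. -/

variable {H : Type*}

/-- `M` is a perfect matching of the elements of `H`. -/
def IsPairing (M : Finset (Sym2 H)) : Prop :=
  (∀ e ∈ M, ¬ e.IsDiag) ∧ ∀ h, ∃! e, e ∈ M ∧ h ∈ e

theorem IsPairing.eq_of_mem {M : Finset (Sym2 H)} (hM : IsPairing M) {e f : Sym2 H} {h : H}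
    (he : e ∈ M) (hf : f ∈ M) (hhe : h ∈ e) (hhf : h ∈ f) : e = f :=
  (hM.2 h).unique ⟨he, hhe⟩ ⟨hf, hhf⟩

/-- `U` consists of disjoint pairs of distinct elements. -/
def IsPartialPairing (U : Finset (Sym2 H)) : Prop :=
  (∀ e ∈ U, ¬ e.IsDiag) ∧ ∀ e ∈ U, ∀ f ∈ U, ∀ h, h ∈ e → h ∈ f → e = f

theorem IsPairing.isPartialPairing {M U : Finset (Sym2 H)} (hM : IsPairing M) (hU : U ⊆ M) :
    IsPartialPairing U :=
  ⟨fun e he => hM.1 e (hU he), fun _ he _ hf _ => hM.eq_of_mem (hU he) (hU hf)⟩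

theorem IsPairing.image_equiv [DecidableEq H] {M : Finset (Sym2 H)} (hM : IsPairing M) (π : Equiv.Perm H) :
    IsPairing (M.image (Sym2.map π)) := by
  constructor
  · intro e he
    obtain ⟨f, hf, rfl⟩ := Finset.mem_image.1 he
    rw [Sym2.isDiag_map π.injective]
    exact hM.1 f hf
  · intro h
    obtain ⟨e, ⟨he, hhe⟩, hu⟩ := hM.2 (π.symm h)
    refine ⟨e.map π, ⟨Finset.mem_image_of_mem _ he, Sym2.mem_map.2 ⟨_, hhe, by simp⟩⟩, ?_⟩
    rintro f ⟨hf, hhf⟩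
    obtain ⟨g, hg, rfl⟩ := Finset.mem_image.1 hf
    obtain ⟨x, hx, rfl⟩ := Sym2.mem_map.1 hhf
    rw [hu g ⟨hg, by simpa using hx⟩]

variable [Fintype H] [DecidableEq H]

open Classical in
/-- The perfect matchings that contain all pairs in `U`. -/
noncomputable def pairingsContaining (U : Finset (Sym2 H)) : Finset (Finset (Sym2 H)) :=
  Finset.univ.filter fun M => IsPairing M ∧ U ⊆ M

theorem mem_pairingsContaining {U M : Finset (Sym2 H)} :
    M ∈ pairingsContaining U ↔ IsPairing M ∧ U ⊆ M := by
  simp [pairingsContaining]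

/-- The elements of `H` not covered by `U`. -/
def uncovered (U : Finset (Sym2 H)) : Finset H :=
  Finset.univ.filter fun h => ∀ e ∈ U, h ∉ e

theorem mem_uncovered {U : Finset (Sym2 H)} {h : H} : h ∈ uncovered U ↔ ∀ e ∈ U, h ∉ e := by
  simp [uncovered]

theorem card_uncovered_add {U : Finset (Sym2 H)} (hU : IsPartialPairing U) :
    (uncovered U).card + 2 * U.card = Fintype.card H := by
  have h1 : uncovered U = (U.biUnion Sym2.toFinset)ᶜ := by
    ext h
    simp [mem_uncovered]
  have h2 : (U.biUnion Sym2.toFinset).card = 2 * U.card := by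
    rw [Finset.card_biUnion, Finset.sum_congr rfl
      (fun e he => Sym2.card_toFinset_of_not_isDiag e (hU.1 e he))]
    · simp [mul_comm]
    · intro e he f hf hne
      change Disjoint e.toFinset f.toFinset
      rw [Finset.disjoint_left]
      intro h hhe hhf
      exact hne (hU.2 e he f hf h (by simpa using hhe) (by simpa using hhf))
  rw [h1, ← h2, add_comm, Finset.card_add_card_compl]

theorem pairingsContaining_eq_biUnion {U : Finset (Sym2 H)} {h : H} (hh : h ∈ uncovered U) :
    pairingsContaining U =
      ((uncovered U).erase h).biUnion fun h' => pairingsContaining (insert s(h, h') U) := by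
  ext M
  simp only [Finset.mem_biUnion, mem_pairingsContaining, Finset.insert_subset_iff,
    Finset.mem_erase]
  constructor
  · rintro ⟨hM, hUM⟩
    obtain ⟨e, ⟨he, hhe⟩, -⟩ := hM.2 h
    obtain ⟨h', rfl⟩ := hhe
    refine ⟨h', ⟨?_, ?_⟩, hM, he, hUM⟩
    · rintro rfl
      exact hM.1 _ he rfl
    · rw [mem_uncovered] at hh ⊢
      intro f hf hf'
      have := hM.eq_of_mem he (hUM hf) (Sym2.mem_mk_right h h') hf'
      exact hh f hf (this ▸ Sym2.mem_mk_left h h')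
  · rintro ⟨_, _, hM, _, hUM⟩
    exact ⟨hM, hUM⟩

/-- Relabelling by the transposition of `h₁` and `h₂` fixes `h` and every pair of `U`, so it maps
the first set of matchings injectively into the second. Used in both directions, it shows that all
partners of `h` are equally likely. -/
theorem card_pairingsContaining_insert_le {U : Finset (Sym2 H)} {h h₁ h₂ : H}
    (hh₁ : h₁ ∈ (uncovered U).erase h)
    (hh₂ : h₂ ∈ (uncovered U).erase h) :
    (pairingsContaining (insert s(h, h₁) U)).card ≤
      (pairingsContaining (insert s(h, h₂) U)).card := by
  set π := Equiv.swap h₁ h₂ with hπ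
  rw [Finset.mem_erase] at hh₁ hh₂
  apply Finset.card_le_card_of_injOn (fun M => M.image (Sym2.map π))
  · intro M hM
    simp only [Finset.mem_coe, mem_pairingsContaining, Finset.insert_subset_iff] at hM ⊢
    obtain ⟨hM, he, hU⟩ := hM
    refine ⟨hM.image_equiv π, ?_, ?_⟩
    · refine Finset.mem_image.2 ⟨_, he, ?_⟩
      rw [Sym2.map_mk, hπ, Equiv.swap_apply_left,
        Equiv.swap_apply_of_ne_of_ne hh₁.1.symm hh₂.1.symm]
    · intro e heU
      refine Finset.mem_image.2 ⟨e, hU heU, ?_⟩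
      have : ∀ x ∈ e, π x = x := fun x hx => by
        rw [hπ, Equiv.swap_apply_of_ne_of_ne]
        · rintro rfl; exact mem_uncovered.1 hh₁.2 e heU hx
        · rintro rfl; exact mem_uncovered.1 hh₂.2 e heU hx
      calc Sym2.map π e = Sym2.map id e := Sym2.map_congr this
        _ = e := by simp
  · intro M _ N _ hMN
    exact Finset.image_injective (Sym2.map.injective π.injective) hMN

/-- The uncovered `h` has `Fintype.card H - 1 - 2 * U.card` possible partners, and by symmetry each
occurs equally often. -/
theorem card_pairingsContaining_insert {U : Finset (Sym2 H)} (hU : IsPartialPairing U) {h h' : H}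
    (hh : h ∈ uncovered U) (hh' : h' ∈ (uncovered U).erase h) :
    (pairingsContaining U).card =
      (pairingsContaining (insert s(h, h') U)).card * (Fintype.card H - 1 - 2 * U.card) := by
  rw [pairingsContaining_eq_biUnion hh, Finset.card_biUnion, Finset.sum_congr rfl
    (fun x hx => le_antisymm (card_pairingsContaining_insert_le hx hh')
      (card_pairingsContaining_insert_le hh' hx))]
  · rw [Finset.sum_const, smul_eq_mul, mul_comm, Finset.card_erase_of_mem hh,
      ← card_uncovered_add hU]
    congr 1
    omega
  · intro x hx y hy hne
    change Disjoint _ _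
    rw [Finset.disjoint_left]
    intro M hMx hMy
    simp only [mem_pairingsContaining, Finset.insert_subset_iff] at hMx hMy
    have := hMx.1.eq_of_mem hMx.2.1 hMy.2.1 (Sym2.mem_mk_left _ _) (Sym2.mem_mk_left _ _)
    exact hne (Sym2.congr_right.1 this)

theorem card_pairingsContaining_mul {U : Finset (Sym2 H)} (hU : IsPartialPairing U) :
    (pairingsContaining U).card * ∏ i ∈ Finset.range U.card, (Fintype.card H - 1 - 2 * i) =
      (pairingsContaining (∅ : Finset (Sym2 H))).card := by
  induction U using Finset.induction_on with
  | empty => simp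
  | insert e U he ih =>
    have hU' : IsPartialPairing U :=
      ⟨fun f hf => hU.1 f (Finset.mem_insert_of_mem hf), fun f hf g hg =>
        hU.2 f (Finset.mem_insert_of_mem hf) g (Finset.mem_insert_of_mem hg)⟩
    have hunc : ∀ x ∈ e, x ∈ uncovered U := fun x hx => mem_uncovered.2 fun f hf hxf =>
      he (hU.2 e (Finset.mem_insert_self _ _) f (Finset.mem_insert_of_mem hf) x hx hxf ▸ hf)
    have hdiag := hU.1 e (Finset.mem_insert_self _ _)
    induction e with
    | h a b =>
      rw [← ih hU', Finset.card_insert_of_notMem he, Finset.prod_range_succ,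
        card_pairingsContaining_insert hU' (hunc a (Sym2.mem_mk_left _ _))
          (Finset.mem_erase.2 ⟨?_, hunc b (Sym2.mem_mk_right _ _)⟩)]
      · ring
      · rintro rfl
        exact hdiag rfl

/-- The inequality survives for arbitrary `U` because overlapping or degenerate pairs lie in no
matching. This is what ears need, since their edges may clash with each other or with the cycles. -/
theorem card_pairingsContaining_mul_le (U : Finset (Sym2 H)) :
    (pairingsContaining U).card * ∏ i ∈ Finset.range U.card, (Fintype.card H - 1 - 2 * i) ≤
      (pairingsContaining (∅ : Finset (Sym2 H))).card := by
  by_cases hU : IsPartialPairing U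
  · exact (card_pairingsContaining_mul hU).le
  · have : pairingsContaining U = ∅ := by
      rw [Finset.eq_empty_iff_forall_notMem]
      intro M hM
      rw [mem_pairingsContaining] at hM
      exact hU (hM.1.isPartialPairing hM.2)
    simp [this]

end Pairing

/-! ### Cyclically linked passages and the edges they use. -/

section Circuits

variable {H V : Type*} {p : H → V}

/-- A passage through a vertex: an ordered pair of distinct half-edges at the same vertex. -/
abbrev Transit (p : H → V) : Type _ := {x : H × H // x.1 ≠ x.2 ∧ p x.1 = p x.2}

namespace Transit

/-- The half-edge through which the vertex is entered. -/
abbrev inn (t : Transit p) : H := t.1.1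

/-- The half-edge through which the vertex is left. -/
abbrev out (t : Transit p) : H := t.1.2

/-- The vertex passed. -/
abbrev vertex (t : Transit p) : V := p t.inn

theorem inn_ne_out (t : Transit p) : t.inn ≠ t.out := t.2.1

theorem vertex_out (t : Transit p) : p t.out = t.vertex := t.2.2.symm

/-- The passage in the opposite direction. -/
def swap (t : Transit p) : Transit p := ⟨(t.out, t.inn), t.2.1.symm, t.2.2.symm⟩

@[simp] theorem swap_inn (t : Transit p) : t.swap.inn = t.out := rfl

@[simp] theorem swap_out (t : Transit p) : t.swap.out = t.inn := rfl

theorem swap_vertex (t : Transit p) : t.swap.vertex = t.vertex := t.vertex_out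

theorem ext' {t u : Transit p} (h : t.inn = u.inn) (h' : t.out = u.out) : t = u :=
  Subtype.ext (Prod.ext h h')

end Transit

variable {I I' : Type*} {σ : Equiv.Perm I} {σ' : Equiv.Perm I'} {c : I → Transit p}
  {c' : I' → Transit p}

/-- The passages are through different vertices. -/
def VertexInjective (c : I → Transit p) : Prop := Function.Injective fun x => (c x).vertex

/-- The edge from the passage `c x` to the passage `c (σ x)`. -/
def linkEdge (σ : Equiv.Perm I) (c : I → Transit p) (x : I) : Sym2 H :=
  s((c x).out, (c (σ x)).inn)

namespace VertexInjective

theorem inn_inj (hc : VertexInjective c) {x y : I} (h : (c x).inn = (c y).inn) : x = y :=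
  hc (congrArg p h)

theorem out_inj (hc : VertexInjective c) {x y : I} (h : (c x).out = (c y).out) : x = y :=
  hc ((c x).vertex_out.symm.trans ((congrArg p h).trans (c y).vertex_out))

theorem out_ne_inn (hc : VertexInjective c) (x y : I) : (c x).out ≠ (c y).inn := by
  intro h
  have : x = y := hc ((c x).vertex_out.symm.trans (congrArg p h))
  subst this
  exact (c x).inn_ne_out h.symm

theorem swap (hc : VertexInjective c) : VertexInjective fun x => (c x).swap := fun x y h =>
  hc ((c x).swap_vertex.symm.trans (h.trans (c y).swap_vertex))

theorem comp (hc : VertexInjective c) {f : I' → I} (hf : Function.Injective f) :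
    VertexInjective (c ∘ f) :=
  fun _ _ h => hf (hc h)

theorem eq_of_mem_linkEdge (hc : VertexInjective c) {x y : I} {h : H} (hx : h ∈ linkEdge σ c x)
    (hy : h ∈ linkEdge σ c y) : x = y := by
  rw [linkEdge, Sym2.mem_iff] at hx hy
  rcases hx with rfl | rfl <;> rcases hy with hy | hy
  · exact hc.out_inj hy
  · exact absurd hy (hc.out_ne_inn _ _)
  · exact absurd hy.symm (hc.out_ne_inn _ _)
  · exact σ.injective (hc.inn_inj hy)

theorem linkEdge_injective (hc : VertexInjective c) : Function.Injective (linkEdge σ c) :=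
  fun x y h => hc.eq_of_mem_linkEdge (σ := σ) (h := (c x).out)
    (by simp [linkEdge]) (by rw [← h, linkEdge]; simp)

theorem not_isDiag_linkEdge (hc : VertexInjective c) (x : I) : ¬ (linkEdge σ c x).IsDiag :=
  fun h => hc.out_ne_inn _ _ h

end VertexInjective

theorem linkEdge_swap (σ : Equiv.Perm I) (c : I → Transit p) (x : I) :
    linkEdge σ⁻¹ (fun x => (c x).swap) (σ x) = linkEdge σ c x := by
  simp [linkEdge, Sym2.eq_swap]

theorem vertex_of_mem_linkEdge {x : I} {h : H} (hx : h ∈ linkEdge σ c x) :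
    ∃ y, p h = (c y).vertex := by
  rw [linkEdge, Sym2.mem_iff] at hx
  rcases hx with rfl | rfl
  · exact ⟨x, (c x).vertex_out⟩
  · exact ⟨σ x, rfl⟩

theorem eq_inn_or_out_of_mem_linkEdge {x : I} {h : H} (hx : h ∈ linkEdge σ c x) :
    ∃ y, h = (c y).inn ∨ h = (c y).out := by
  rw [linkEdge, Sym2.mem_iff] at hx
  rcases hx with rfl | rfl
  · exact ⟨x, Or.inr rfl⟩
  · exact ⟨σ x, Or.inl rfl⟩

theorem linkEdge_sigma {J : Type*} {K : J → Type*} (τ : ∀ j, Equiv.Perm (K j)) (c : (Σ j, K j) → Transit p) (j : J)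
    (x : K j) :
    linkEdge (Equiv.sigmaCongrRight τ) c ⟨j, x⟩ = linkEdge (τ j) (fun x => c ⟨j, x⟩) x := rfl

variable [DecidableEq H] [Fintype I] [Fintype I']

/-- The edges of a family of cyclically linked passages. -/
def links (σ : Equiv.Perm I) (c : I → Transit p) : Finset (Sym2 H) :=
  Finset.univ.image (linkEdge σ c)

theorem mem_links {e : Sym2 H} : e ∈ links σ c ↔ ∃ x, linkEdge σ c x = e := by
  simp [links]

theorem linkEdge_mem_links (σ : Equiv.Perm I) (c : I → Transit p) (x : I) :
    linkEdge σ c x ∈ links σ c :=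
  mem_links.2 ⟨x, rfl⟩

theorem VertexInjective.card_links (hc : VertexInjective c) :
    (links σ c).card = Fintype.card I := by
  rw [links, Finset.card_image_of_injective _ hc.linkEdge_injective, Finset.card_univ]

theorem VertexInjective.isPartialPairing_links (hc : VertexInjective c) :
    IsPartialPairing (links σ c) := by
  constructor
  · intro e he
    obtain ⟨x, rfl⟩ := mem_links.1 he
    exact hc.not_isDiag_linkEdge x
  · intro e he f hf h hhe hhf
    obtain ⟨x, rfl⟩ := mem_links.1 he
    obtain ⟨y, rfl⟩ := mem_links.1 hf
    rw [hc.eq_of_mem_linkEdge hhe hhf]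

theorem links_swap (σ : Equiv.Perm I) (c : I → Transit p) :
    links σ⁻¹ (fun x => (c x).swap) = links σ c := by
  ext e
  rw [mem_links, mem_links]
  constructor
  · rintro ⟨x, rfl⟩
    exact ⟨σ⁻¹ x, by rw [← linkEdge_swap]; simp⟩
  · rintro ⟨x, rfl⟩
    exact ⟨σ x, linkEdge_swap σ c x⟩

theorem inn_mem_links (σ : Equiv.Perm I) (c : I → Transit p) (x : I) :
    ∃ e ∈ links σ c, (c x).inn ∈ e :=
  ⟨_, linkEdge_mem_links σ c (σ⁻¹ x), by simp [linkEdge]⟩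

theorem out_mem_links (σ : Equiv.Perm I) (c : I → Transit p) (x : I) :
    ∃ e ∈ links σ c, (c x).out ∈ e :=
  ⟨_, linkEdge_mem_links σ c x, by simp [linkEdge]⟩

/-- A passage that uses the edges of `c` only agrees, up to direction, with that of `c` through the
same vertex. -/
theorem VertexInjective.transit_eq_or (hc : VertexInjective c) (hs : links σ' c' ⊆ links σ c)
    {x : I} {y : I'} (hxy : (c' y).vertex = (c x).vertex) : c' y = c x ∨ c' y = (c x).swap := by
  -- Since `c` visits each vertex at most once, its edges cover only two half-edges at the vertex of
  -- `c x`.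
  have key : ∀ h : H, (∃ e ∈ links σ' c', h ∈ e) → p h = (c x).vertex →
      h = (c x).inn ∨ h = (c x).out := by
    rintro h ⟨e, he, hhe⟩ hp
    obtain ⟨z, rfl⟩ := mem_links.1 (hs he)
    obtain ⟨w, hw⟩ := eq_inn_or_out_of_mem_linkEdge hhe
    have : w = x := hc (by
      rcases hw with rfl | rfl
      · exact hp
      · exact (c w).vertex_out.symm.trans hp)
    exact this ▸ hw
  have h1 := key _ (inn_mem_links σ' c' y) hxy
  have h2 := key _ (out_mem_links σ' c' y) ((c' y).vertex_out.trans hxy)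
  have hne := (c' y).inn_ne_out
  rcases h1 with h1 | h1 <;> rcases h2 with h2 | h2
  · exact absurd (h1.trans h2.symm) hne
  · exact Or.inl (Transit.ext' h1 h2)
  · exact Or.inr (Transit.ext' h1 h2)
  · exact absurd (h1.trans h2.symm) hne

theorem VertexInjective.linkEdge_eq (hc : VertexInjective c) (hs : links σ' c' ⊆ links σ c)
    {x : I} {y : I'} (hxy : c' y = c x) : linkEdge σ' c' y = linkEdge σ c x := by
  obtain ⟨z, hz⟩ := mem_links.1 (hs (linkEdge_mem_links σ' c' y))
  have : z = x := hc.eq_of_mem_linkEdge (σ := σ) (h := (c x).out)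
    (by rw [hz, linkEdge, hxy]; simp) (by simp [linkEdge])
  rw [← hz, this]

/-- Agreement in one passage propagates. The edge leaving it is the same, so the next passage is
entered through the same half-edge, which excludes the reversed passage. -/
theorem VertexInjective.transit_succ (hc : VertexInjective c) (hs : links σ' c' ⊆ links σ c)
    {x : I} {y : I'} (hxy : c' y = c x) : c' (σ' y) = c (σ x) := by
  have h := hc.linkEdge_eq hs hxy
  rw [linkEdge, linkEdge, hxy, Sym2.congr_right] at h
  rcases hc.transit_eq_or hs (congrArg p h) with h' | h'
  · exact h'
  · rw [h'] at h
    exact absurd h.symm (c (σ x)).inn_ne_out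

/-- The only invariant sets of the permutation are the trivial ones. -/
def IsTransitivePerm (σ : Equiv.Perm I) : Prop :=
  ∀ s : Set I, s.Nonempty → Set.MapsTo σ s s → s = Set.univ

/-- On a finite type an injective map of `s` into itself is onto `s`, so invariance under `σ⁻¹`
gives invariance under `σ`. -/
theorem IsTransitivePerm.inv (h : IsTransitivePerm σ) : IsTransitivePerm σ⁻¹ := by
  intro s hs hm
  refine h s hs ?_
  have heq : ⇑σ⁻¹ '' s = s := Set.eq_of_subset_of_ncard_le hm.image_subset
    (Set.ncard_image_of_injective s σ⁻¹.injective).ge (Set.toFinite s)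
  intro x hx
  obtain ⟨y, hy, rfl⟩ := heq.symm ▸ hx
  simpa using hy

theorem isTransitivePerm_finRotate (k : ℕ) : IsTransitivePerm (finRotate k) := by
  intro s hs hm
  obtain ⟨x, hx⟩ := hs
  rcases k with _ | k
  · exact x.elim0
  have key : ∀ j : Fin (k + 1), x + j ∈ s := by
    intro j
    induction j using Fin.induction with
    | zero => simpa using hx
    | succ j ih =>
      have := hm ih
      rwa [finRotate_apply, add_assoc, Fin.coeSucc_eq_succ] at this
  refine Set.eq_univ_of_forall fun y => ?_
  simpa using key (y - x)

section Sigma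

variable {J : Type*} [Fintype J] {K : J → Type*} [∀ j, Fintype (K j)]
  {τ : ∀ j, Equiv.Perm (K j)} {c : (Σ j, K j) → Transit p}

theorem links_sigma (τ : ∀ j, Equiv.Perm (K j)) (c : (Σ j, K j) → Transit p) :
    links (Equiv.sigmaCongrRight τ) c =
      Finset.univ.biUnion fun j => links (τ j) fun x => c ⟨j, x⟩ := by
  ext e
  simp only [mem_links, Finset.mem_biUnion, Finset.mem_univ, true_and, Sigma.exists,
    linkEdge_sigma]

/-- The indices at which the two cycles agree are closed under the successor on either side, so by
transitivity they exhaust both cycles. -/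
theorem VertexInjective.links_eq_of_transit_eq (hc : VertexInjective c)
    (hτ : ∀ j, IsTransitivePerm (τ j)) (hσ' : IsTransitivePerm σ')
    (hs : links σ' c' ⊆ links (Equiv.sigmaCongrRight τ) c) {j : J} {x : K j} {y : I'}
    (hxy : c' y = c ⟨j, x⟩) : links σ' c' = links (τ j) fun x => c ⟨j, x⟩ := by
  have h1 : {x : K j | ∃ y, c' y = c ⟨j, x⟩} = Set.univ := by
    refine hτ j _ ⟨x, y, hxy⟩ ?_
    rintro x ⟨y, hxy⟩
    exact ⟨σ' y, hc.transit_succ hs hxy⟩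
  have h2 : {y : I' | ∃ x, c' y = c ⟨j, x⟩} = Set.univ := by
    refine hσ' _ ⟨y, x, hxy⟩ ?_
    rintro y ⟨x, hxy⟩
    exact ⟨τ j x, hc.transit_succ hs hxy⟩
  ext e
  rw [mem_links, mem_links]
  constructor
  · rintro ⟨y, rfl⟩
    obtain ⟨x, hxy⟩ : y ∈ {y : I' | ∃ x, c' y = c ⟨j, x⟩} := h2 ▸ Set.mem_univ y
    exact ⟨x, (hc.linkEdge_eq hs hxy).symm⟩
  · rintro ⟨x, rfl⟩
    obtain ⟨y, hxy⟩ : x ∈ {x : K j | ∃ y, c' y = c ⟨j, x⟩} := h1 ▸ Set.mem_univ x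
    exact ⟨y, hc.linkEdge_eq hs hxy⟩

/-- A cycle that only uses edges of a union of vertex-disjoint cycles is one of these. -/
theorem VertexInjective.links_eq_of_subset (hc : VertexInjective c)
    (hτ : ∀ j, IsTransitivePerm (τ j)) (hσ' : IsTransitivePerm σ')
    (hs : links σ' c' ⊆ links (Equiv.sigmaCongrRight τ) c) {j : J} {x : K j} {y : I'}
    (hxy : (c' y).vertex = (c ⟨j, x⟩).vertex) : links σ' c' = links (τ j) fun x => c ⟨j, x⟩ := by
  rcases hc.transit_eq_or hs hxy with h | h
  · exact hc.links_eq_of_transit_eq hτ hσ' hs h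
  -- If the common vertex is passed in the opposite direction, the whole family is reversed; its
  -- edges do not change.
  · rw [← links_swap (τ j)]
    refine VertexInjective.links_eq_of_transit_eq (τ := fun j => (τ j)⁻¹)
      (c := fun x => (c x).swap) hc.swap (fun j => (hτ j).inv) hσ' ?_ h
    exact (links_swap (Equiv.sigmaCongrRight τ) c).symm ▸ hs

end Sigma

end Circuits

/-! ### The representations of one cycle: choice of root and direction. -/

section CycleFibre

variable {H V : Type*} {p : H → V}

/-- The representation of the cycle `c` that starts with the passage `c i`, in the same or in the
opposite direction. -/
def rerooted {k : ℕ} (c : Fin (k + 1) → Transit p) (i : Fin (k + 1)) :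
    Bool → Fin (k + 1) → Transit p
  | false, j => c (i + j)
  | true, j => (c (i - j)).swap

theorem VertexInjective.rerooted {k : ℕ} {c : Fin (k + 1) → Transit p} (hc : VertexInjective c)
    (i : Fin (k + 1)) (b : Bool) : VertexInjective (rerooted c i b) := by
  cases b
  · exact hc.comp (add_right_injective i)
  · exact hc.swap.comp (f := fun j => i - j) (sub_right_injective (b := i))

/-- The half-edge through which the first passage is entered already determines root and direction,
because the half-edges used by `c` are all distinct. -/
theorem rerooted_injective {k : ℕ} {c : Fin (k + 1) → Transit p} (hc : VertexInjective c) :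
    Function.Injective fun x : Fin (k + 1) × Bool => rerooted c x.1 x.2 := by
  rintro ⟨i, b⟩ ⟨i', b'⟩ h
  have h0 : (rerooted c i b 0).inn = (rerooted c i' b' 0).inn := by
    rw [show rerooted c i b = rerooted c i' b' from h]
  cases b <;> cases b' <;> simp only [rerooted, add_zero, sub_zero, Transit.swap_inn] at h0
  · rw [hc.inn_inj h0]
  · exact absurd h0.symm (hc.out_ne_inn _ _)
  · exact absurd h0 (hc.out_ne_inn _ _)
  · rw [hc.out_inj h0]

variable [DecidableEq H]

theorem links_rerooted {k : ℕ} (c : Fin (k + 1) → Transit p) (i : Fin (k + 1)) (b : Bool) :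
    links (finRotate (k + 1)) (rerooted c i b) = links (finRotate (k + 1)) c := by
  cases b
  · have h : ∀ j, linkEdge (finRotate (k + 1)) (rerooted c i false) j =
        linkEdge (finRotate (k + 1)) c (i + j) := fun j => by
      simp [linkEdge, rerooted, add_assoc]
    ext e
    rw [mem_links, mem_links]
    constructor
    · rintro ⟨j, rfl⟩
      exact ⟨_, (h j).symm⟩
    · rintro ⟨j, rfl⟩
      exact ⟨j - i, by rw [h]; simp⟩
  · have h : ∀ j, linkEdge (finRotate (k + 1)) (rerooted c i true) j =
        linkEdge (finRotate (k + 1)) c (i - j - 1) := fun j => by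
      simp only [linkEdge, rerooted, finRotate_apply, Transit.swap_inn, Transit.swap_out,
        sub_add_cancel]
      rw [← sub_sub]
      exact Sym2.eq_swap
    ext e
    rw [mem_links, mem_links]
    constructor
    · rintro ⟨j, rfl⟩
      exact ⟨_, (h j).symm⟩
    · rintro ⟨j, rfl⟩
      exact ⟨i - 1 - j, by rw [h]; congr 1; abel⟩

/-- The first passage of `c'` shares its vertex with some `c i` and hence equals it up to direction.
This fixes root and direction, and `transit_succ` carries the agreement around the cycle. -/
theorem exists_rerooted_eq {k : ℕ} {c c' : Fin (k + 1) → Transit p} (hc : VertexInjective c)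
    (h : links (finRotate (k + 1)) c' = links (finRotate (k + 1)) c) :
    ∃ x : Fin (k + 1) × Bool, rerooted c x.1 x.2 = c' := by
  obtain ⟨i, hi⟩ : ∃ i, (c' 0).vertex = (c i).vertex := by
    obtain ⟨e, he, h0⟩ := inn_mem_links (finRotate (k + 1)) c' 0
    obtain ⟨x, rfl⟩ := mem_links.1 (h ▸ he)
    exact vertex_of_mem_linkEdge h0
  have key : ∀ b, c' 0 = rerooted c i b 0 → c' = rerooted c i b := by
    intro b h0
    have hs := (h.trans (links_rerooted c i b).symm).subset
    funext j
    induction j using Fin.induction with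
    | zero => exact h0
    | succ j ih =>
      simpa using (hc.rerooted i b).transit_succ hs ih
  rcases hc.transit_eq_or h.subset hi with h' | h'
  · exact ⟨(i, false), (key false (by simpa [rerooted] using h')).symm⟩
  · exact ⟨(i, true), (key true (by simpa [rerooted] using h')).symm⟩

/-- A cycle of length `k` has `2 k` representations as a cyclic sequence of passages. -/
theorem card_fibre_links {k : ℕ} (hk : 1 ≤ k) [Fintype (Fin k → Transit p)]
    {c : Fin k → Transit p} (hc : VertexInjective c)
    [DecidablePred fun c' : Fin k → Transit p => VertexInjective c' ∧
      links (finRotate k) c' = links (finRotate k) c] :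
    (Finset.univ.filter fun c' : Fin k → Transit p => VertexInjective c' ∧
      links (finRotate k) c' = links (finRotate k) c).card = 2 * k := by
  obtain ⟨k, rfl⟩ := Nat.exists_eq_add_of_le' hk
  have h : (Finset.univ.filter fun c' : Fin (k + 1) → Transit p => VertexInjective c' ∧
      links (finRotate (k + 1)) c' = links (finRotate (k + 1)) c) =
      Finset.univ.map ⟨_, rerooted_injective hc⟩ := by
    ext c'
    simp only [Finset.mem_filter, Finset.mem_univ, true_and, Finset.mem_map,
      Function.Embedding.coeFn_mk]
    constructor
    · rintro ⟨-, h⟩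
      exact exists_rerooted_eq hc h
    · rintro ⟨x, rfl⟩
      exact ⟨hc.rerooted _ _, links_rerooted _ _ _⟩
  rw [h, Finset.card_map, Finset.card_univ]
  simp [mul_comm]

end CycleFibre

/-! ### Ears: walks outside a system of cycles with both ends on it. -/

section Ears

variable {H V : Type*} {p : H → V}

/-- The edges of the walk that leaves through the half-edge `x.2.1`, makes the passages `x.1` and
arrives through the half-edge `x.2.2`. -/
def walkEdge {l : ℕ} (x : (Fin l → Transit p) × H × H) (i : Fin (l + 1)) : Sym2 H :=
  s((Fin.cons x.2.1 fun j => (x.1 j).out : Fin (l + 1) → H) i,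
    (Fin.snoc (fun j => (x.1 j).inn) x.2.2 : Fin (l + 1) → H) i)

variable [DecidableEq H] {I : Type*} [Fintype I]

/-- The walk `x` starts and ends at vertices of `c`, and its edges are distinct elements of `M`
that are not edges of `c`. -/
structure IsEar (M : Finset (Sym2 H)) (σ : Equiv.Perm I) (c : I → Transit p) {l : ℕ}
    (x : (Fin l → Transit p) × H × H) : Prop where
  start : ∃ y, p x.2.1 = (c y).vertex
  finish : ∃ y, p x.2.2 = (c y).vertex
  injective : Function.Injective (walkEdge x)
  mem : ∀ i, walkEdge x i ∈ M
  notMem : ∀ i, walkEdge x i ∉ links σ c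

theorem finRotate_pow_apply {k : ℕ} (n : ℕ) (y : Fin (k + 1)) :
    (((finRotate (k + 1)) ^ n) y : ℕ) = (y + n) % (k + 1) := by
  induction n with
  | zero => simp [Nat.mod_eq_of_lt y.2]
  | succ n ih =>
    rw [pow_succ', Equiv.Perm.mul_apply, finRotate_apply, Fin.val_add, ih]
    simp [Nat.add_assoc]

theorem finRotate_pow_self {k : ℕ} (y : Fin (k + 1)) :
    ((finRotate (k + 1)) ^ (k + 1)) y = y := by
  apply Fin.ext
  rw [finRotate_pow_apply]
  simp [Nat.mod_eq_of_lt y.2]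

theorem finRotate_pow_apply_inj {k i j : ℕ} (y : Fin (k + 1)) (hi : i ≤ k) (hj : j ≤ k)
    (h : ((finRotate (k + 1)) ^ i) y = ((finRotate (k + 1)) ^ j) y) : i = j := by
  have h' := congrArg Fin.val h
  rw [finRotate_pow_apply, finRotate_pow_apply] at h'
  have h'' : i ≡ j [MOD (k + 1)] := Nat.ModEq.add_left_cancel' (y : ℕ) h'
  exact Nat.ModEq.eq_of_lt_of_lt h'' (by omega) (by omega)

variable {σ : Equiv.Perm I} {c : I → Transit p} {M : Finset (Sym2 H)}

/-- Follow `c'` from `y` until it meets `c` again. The segment traversed is an ear, unless it is a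
single edge of `c`; in that case the walk has merely advanced along `c`. -/
theorem exists_isEar_or_step {k : ℕ} {c' : Fin (k + 1) → Transit p} (hc' : VertexInjective c')
    (hM : links (finRotate (k + 1)) c' ⊆ M) {y : Fin (k + 1)}
    (hy : ∃ x, (c' y).vertex = (c x).vertex) :
    (∃ l ≤ k, ∃ x : (Fin l → Transit p) × H × H, IsEar M σ c x) ∨
      (linkEdge (finRotate (k + 1)) c' y ∈ links σ c ∧
        ∃ x, (c' (finRotate (k + 1) y)).vertex = (c x).vertex) := by
  classical
  set ρ := finRotate (k + 1) with hρ
  -- A return to `c` occurs at the latest after a full turn; `l + 1` will be the first return time,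
  -- so `l` counts the passages strictly in between.
  have hex : ∃ l, ∃ x, (c' ((ρ ^ (l + 1)) y)).vertex = (c x).vertex :=
    ⟨k, by rwa [hρ, finRotate_pow_self]⟩
  set l := Nat.find hex with hl
  have hlk : l ≤ k := Nat.find_min' hex (by rwa [hρ, finRotate_pow_self])
  have hend : ∃ x, (c' ((ρ ^ (l + 1)) y)).vertex = (c x).vertex := Nat.find_spec hex
  have hmin : ∀ i, 0 < i → i ≤ l → ¬ ∃ x, (c' ((ρ ^ i) y)).vertex = (c x).vertex := by
    intro i hi hil
    have := Nat.find_min hex (m := i - 1) (by omega)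
    rwa [Nat.sub_add_cancel hi] at this
  by_cases htriv : l = 0 ∧ linkEdge ρ c' y ∈ links σ c
  · right
    refine ⟨htriv.2, ?_⟩
    simpa [htriv.1] using hend
  · left
    refine ⟨l, hlk, (fun i => c' ((ρ ^ ((i : ℕ) + 1)) y), (c' y).out,
      (c' ((ρ ^ (l + 1)) y)).inn), ?_⟩
    set w : (Fin l → Transit p) × H × H := (fun i => c' ((ρ ^ ((i : ℕ) + 1)) y), (c' y).out,
      (c' ((ρ ^ (l + 1)) y)).inn) with hw
    have hedge : ∀ i : Fin (l + 1), walkEdge w i = linkEdge ρ c' ((ρ ^ (i : ℕ)) y) := by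
      intro i
      have h1 : (Fin.cons w.2.1 fun j => (w.1 j).out : Fin (l + 1) → H) i =
          (c' ((ρ ^ (i : ℕ)) y)).out := by
        induction i using Fin.cases with
        | zero => simp [hw]
        | succ i => simp [hw]
      have h2 : (Fin.snoc (fun j => (w.1 j).inn) w.2.2 : Fin (l + 1) → H) i =
          (c' ((ρ ^ ((i : ℕ) + 1)) y)).inn := by
        induction i using Fin.lastCases with
        | last => simp [hw]
        | cast i => simp [hw]
      rw [walkEdge, h1, h2, linkEdge, ← Equiv.Perm.mul_apply, ← pow_succ']
    refine ⟨?_, hend, ?_, ?_, ?_⟩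
    · obtain ⟨x, hx⟩ := hy
      exact ⟨x, (c' y).vertex_out.trans hx⟩
    · intro i j hij
      rw [hedge, hedge] at hij
      exact Fin.ext (finRotate_pow_apply_inj y (by omega) (by omega)
        (hc'.linkEdge_injective hij))
    · intro i
      rw [hedge]
      exact hM (linkEdge_mem_links _ _ _)
    · intro i hi
      rw [hedge] at hi
      obtain ⟨z, hz⟩ := mem_links.1 hi
      -- An edge with an end off `c` is no edge of `c`. The first edge has such an end at time 1 if
      -- `0 < l`, every later edge at its start; the case `l = 0` is excluded by `htriv`.
      rcases Nat.eq_zero_or_pos (i : ℕ) with h0 | h0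
      · rcases Nat.eq_zero_or_pos l with hl0 | hl0
        · exact htriv ⟨hl0, by simpa [h0] using hi⟩
        · refine hmin 1 one_pos hl0 ?_
          refine vertex_of_mem_linkEdge (h := (c' ((ρ ^ 1) y)).inn) (σ := σ) (x := z) ?_
          rw [hz]
          simp [linkEdge, h0]
      · refine hmin i h0 (by omega) ?_
        simp only [← Transit.vertex_out (c' _)]
        refine vertex_of_mem_linkEdge (σ := σ) (x := z) ?_
        rw [hz]
        simp [linkEdge]

/-- A cycle that meets `c` and has an edge outside `c` contains an ear of `c`. -/
theorem exists_isEar {k : ℕ} {c' : Fin k → Transit p} (hc' : VertexInjective c')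
    (hM : links (finRotate k) c' ⊆ M) (hy : ∃ y x, (c' y).vertex = (c x).vertex)
    (hne : ¬ links (finRotate k) c' ⊆ links σ c) :
    ∃ l < k, ∃ x : (Fin l → Transit p) × H × H, IsEar M σ c x := by
  by_contra hno
  rcases k with _ | k
  · exact hy.choose.elim0
  simp only [Nat.lt_succ_iff] at hno
  -- Without ears, the positions of `c'` that lie on `c` are closed under the successor. So they are
  -- all positions, and every step uses an edge of `c`.
  have huniv := isTransitivePerm_finRotate (k + 1)
    {y | ∃ x, (c' y).vertex = (c x).vertex} hy fun y hy =>
      ((exists_isEar_or_step hc' hM hy).resolve_left hno).2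
  refine hne fun e he => ?_
  obtain ⟨y, rfl⟩ := mem_links.1 he
  exact ((exists_isEar_or_step hc' hM (huniv ▸ Set.mem_univ y :
    y ∈ {y | ∃ x, (c' y).vertex = (c x).vertex})).resolve_left hno).1

end Ears

/-! ### Edge sets of cycles in a matching. -/

section CycleSets

variable {H V : Type*} [DecidableEq H]

/-- The edge sets `E` and `F` have a common vertex. -/
def Touches (p : H → V) (E F : Finset (Sym2 H)) : Prop :=
  ∃ e ∈ E, ∃ f ∈ F, ∃ x ∈ e, ∃ y ∈ f, p x = p y

theorem touches_links_iff {p : H → V} {I I' : Type*} [Fintype I] [Fintype I']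
    {σ : Equiv.Perm I} {σ' : Equiv.Perm I'} {c : I → Transit p} {c' : I' → Transit p} :
    Touches p (links σ c) (links σ' c') ↔ ∃ x y, (c x).vertex = (c' y).vertex := by
  constructor
  · rintro ⟨e, he, f, hf, x, hx, y, hy, hxy⟩
    obtain ⟨a, rfl⟩ := mem_links.1 he
    obtain ⟨b, rfl⟩ := mem_links.1 hf
    obtain ⟨a', ha⟩ := vertex_of_mem_linkEdge hx
    obtain ⟨b', hb⟩ := vertex_of_mem_linkEdge hy
    exact ⟨a', b', by rw [← ha, ← hb, hxy]⟩
  · rintro ⟨x, y, hxy⟩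
    obtain ⟨e, he, hx⟩ := inn_mem_links σ c x
    obtain ⟨f, hf, hy⟩ := inn_mem_links σ' c' y
    exact ⟨e, he, f, hf, _, hx, _, hy, hxy⟩

variable [Fintype H]

open Classical in
/-- The edge sets of the cycles of length `k` formed by the pairs in `M`. -/
noncomputable def cycleSets (p : H → V) (M : Finset (Sym2 H)) (k : ℕ) :
    Finset (Finset (Sym2 H)) :=
  Finset.univ.filter fun E => E ⊆ M ∧
    ∃ c : Fin k → Transit p, VertexInjective c ∧ links (finRotate k) c = E

theorem mem_cycleSets {p : H → V} {M : Finset (Sym2 H)} {k : ℕ} {E : Finset (Sym2 H)} :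
    E ∈ cycleSets p M k ↔ E ⊆ M ∧
      ∃ c : Fin k → Transit p, VertexInjective c ∧ links (finRotate k) c = E := by
  simp [cycleSets]

end CycleSets

/-! ### Cycles of the multigraph correspond to their edge sets. -/

namespace DegreeSequence

variable {n : ℕ} {d : DegreeSequence n}

theorem Configuration.isPairing (M : d.Configuration) : IsPairing M.1 := M.2

/-- The sub-multigraph formed by the edges in `E`. -/
def Configuration.subgraphOf (M : d.Configuration) (E : Finset (Sym2 d.HalfEdge)) (hE : E ⊆ M.1) :
    Graph (Fin n) (Sym2 d.HalfEdge) where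
  vertexSet := {v | ∃ e ∈ E, ∃ h ∈ e, h.1 = v}
  edgeSet := {e | e ∈ E}
  IsLink e u v := e ∈ E ∧ e.map Sigma.fst = s(u, v)
  isLink_symm := fun _ _ => ⟨fun _ _ h => ⟨h.1, h.2.trans Sym2.eq_swap⟩⟩
  eq_or_eq_of_isLink_of_isLink := fun _ _ _ _ _ h h' =>
    M.multigraph.eq_or_eq_of_isLink_of_isLink ⟨hE h.1, h.2⟩ ⟨hE h'.1, h'.2⟩
  edge_mem_iff_exists_isLink := by
    intro e
    constructor
    · intro he
      induction e with
      | h a b => exact ⟨a.1, b.1, he, rfl⟩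
    · rintro ⟨_, _, h, _⟩
      exact h
  left_mem_of_isLink := by
    rintro e u v ⟨he, h⟩
    have hu : u ∈ e.map Sigma.fst := by rw [h]; simp
    obtain ⟨x, hx, rfl⟩ := Sym2.mem_map.1 hu
    exact ⟨e, he, x, hx, rfl⟩

/-- Each edge is oriented along the cycle as an ordered pair of half-edges. The passage at `v i`
enters by the last half-edge of the preceding edge and leaves by the first half-edge of `e i`. -/
theorem Configuration.exists_links_of_isCycleOfLength (M : d.Configuration) {k : ℕ}
    {C : Graph (Fin n) (Sym2 d.HalfEdge)} (hCM : C ≤ M.multigraph) (hC : C.IsCycleOfLength k) :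
    ∃ c : Fin k → Transit (Sigma.fst : d.HalfEdge → Fin n), VertexInjective c ∧
      links (finRotate k) c ⊆ M.1 ∧ C.edgeSet = links (finRotate k) c ∧
      C.vertexSet = Set.range fun i => (c i).vertex := by
  obtain ⟨v, e, hv, he, hV, hE, hlink⟩ := hC
  have hl : ∀ i, e i ∈ M.1 ∧ (e i).map Sigma.fst = s(v i, v (finRotate k i)) := fun i =>
    (hlink i).mono hCM
  have hex : ∀ i, ∃ x : d.HalfEdge × d.HalfEdge,
      e i = s(x.1, x.2) ∧ x.1.1 = v i ∧ x.2.1 = v (finRotate k i) := by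
    intro i
    have h := (hl i).2
    induction h' : e i with
    | h a b =>
      rw [h', Sym2.map_mk, Sym2.eq_iff] at h
      rcases h with h | h
      · exact ⟨(a, b), rfl, h.1, h.2⟩
      · exact ⟨(b, a), Sym2.eq_swap, h.2, h.1⟩
  choose x hx hx1 hx2 using hex
  have hx2' : ∀ i, (x ((finRotate k).symm i)).2.1 = v i := fun i => by
    rw [hx2, Equiv.apply_symm_apply]
  -- A common half-edge would identify consecutive edges, hence their indices, and then make `e i` a
  -- pair of equal half-edges. The argument covers loops (`k = 1`) as well.
  have hne : ∀ i, (x ((finRotate k).symm i)).2 ≠ (x i).1 := by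
    intro i h
    have h1 : e ((finRotate k).symm i) = e i :=
      M.isPairing.eq_of_mem (h := (x i).1) (hl _).1 (hl _).1 (by rw [hx, ← h]; simp)
        (by rw [hx]; simp)
    have h2 := he h1
    rw [h2] at h
    refine M.isPairing.1 _ (hl i).1 ?_
    rw [hx i, h]
    rfl
  let c : Fin k → Transit (Sigma.fst : d.HalfEdge → Fin n) := fun i =>
    ⟨((x ((finRotate k).symm i)).2, (x i).1), hne i, (hx2' i).trans (hx1 i).symm⟩
  have hvert : ∀ i, (c i).vertex = v i := hx2'
  have hedge : ∀ i, linkEdge (finRotate k) c i = e i := fun i => by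
    rw [hx i]
    change s((x i).1, (x ((finRotate k).symm (finRotate k i))).2) = _
    rw [Equiv.symm_apply_apply]
  refine ⟨c, fun i j hij => hv ?_, ?_, ?_, ?_⟩
  · simpa [hvert] using hij
  · intro f hf
    obtain ⟨i, rfl⟩ := mem_links.1 hf
    rw [hedge]
    exact (hl i).1
  · rw [hE]
    ext f
    simp [mem_links, hedge]
  · rw [hV]
    simp only [hvert]

theorem Configuration.subgraphOf_le (M : d.Configuration) {E : Finset (Sym2 d.HalfEdge)}
    (hE : E ⊆ M.1) : M.subgraphOf E hE ≤ M.multigraph :=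
  ⟨fun _ _ => trivial, fun _ _ _ h => ⟨hE h.1, h.2⟩⟩

theorem Configuration.isCycleOfLength_subgraphOf (M : d.Configuration) {k : ℕ}
    {c : Fin k → Transit (Sigma.fst : d.HalfEdge → Fin n)} (hc : VertexInjective c)
    (hE : links (finRotate k) c ⊆ M.1) :
    (M.subgraphOf (links (finRotate k) c) hE).IsCycleOfLength k := by
  refine ⟨fun i => (c i).vertex, linkEdge (finRotate k) c, hc, hc.linkEdge_injective, ?_, ?_, ?_⟩
  · ext v
    constructor
    · rintro ⟨e, he, h, hh, rfl⟩
      obtain ⟨i, rfl⟩ := mem_links.1 he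
      obtain ⟨y, hy⟩ := vertex_of_mem_linkEdge hh
      exact ⟨y, hy.symm⟩
    · rintro ⟨i, rfl⟩
      obtain ⟨e, he, h⟩ := inn_mem_links (finRotate k) c i
      exact ⟨e, he, _, h, rfl⟩
  · ext f
    change f ∈ links (finRotate k) c ↔ _
    simp [mem_links]
  · intro i
    refine ⟨linkEdge_mem_links _ _ _, ?_⟩
    exact congrArg₂ (fun a b => s(a, b)) (c i).vertex_out rfl

/-- A cycle has no isolated vertices, so as a subgraph it is determined by its edge set. -/
theorem Configuration.cycleCount_eq_card (M : d.Configuration) (k : ℕ) :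
    M.multigraph.cycleCount k =
      (cycleSets (Sigma.fst : d.HalfEdge → Fin n) M.1 k).card := by
  rw [Graph.cycleCount, ← Set.ncard_coe_finset]
  refine Set.ncard_congr (fun C _ => (Set.toFinite C.edgeSet).toFinset) ?_ ?_ ?_
  · rintro C ⟨hCM, hC⟩
    obtain ⟨c, hc, hcM, hCE, -⟩ := M.exists_links_of_isCycleOfLength hCM hC
    have : (Set.toFinite C.edgeSet).toFinset = links (finRotate k) c := by
      ext e; simp [hCE]
    rw [this, Finset.mem_coe, mem_cycleSets]
    exact ⟨hcM, c, hc, rfl⟩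
  · rintro C C' ⟨hCM, hC⟩ ⟨hCM', hC'⟩ h
    have hE : C.edgeSet = C'.edgeSet := by simpa using h
    have hV : ∀ {C : Graph (Fin n) (Sym2 d.HalfEdge)}, C ≤ M.multigraph → C.IsCycleOfLength k →
        C.vertexSet = {v | ∃ e ∈ C.edgeSet, ∃ h ∈ e, h.1 = v} := by
      intro C hCM hC
      obtain ⟨c, hc, hcM, hCE, hCV⟩ := M.exists_links_of_isCycleOfLength hCM hC
      rw [hCV, hCE]
      ext u
      constructor
      · rintro ⟨i, rfl⟩
        obtain ⟨e, he, h⟩ := inn_mem_links (finRotate k) c i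
        exact ⟨e, he, _, h, rfl⟩
      · rintro ⟨e, he, h, hh, rfl⟩
        obtain ⟨i, rfl⟩ := mem_links.1 he
        obtain ⟨y, hy⟩ := vertex_of_mem_linkEdge hh
        exact ⟨y, hy.symm⟩
    refine Graph.ext ((hV hCM hC).trans (hE ▸ (hV hCM' hC').symm)) fun e u v => ?_
    by_cases he : e ∈ C.edgeSet
    · exact (Graph.IsSubgraph.isLink_iff hCM he).trans
        (Graph.IsSubgraph.isLink_iff hCM' (hE ▸ he)).symm
    · exact iff_of_false (fun h => he h.edge_mem) fun h => he (hE ▸ h.edge_mem)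
  · intro E hE
    rw [Finset.mem_coe, mem_cycleSets] at hE
    obtain ⟨hEM, c, hc, rfl⟩ := hE
    refine ⟨M.subgraphOf _ hEM, ⟨M.subgraphOf_le hEM, M.isCycleOfLength_subgraphOf hc hEM⟩, ?_⟩
    ext e
    simp [Configuration.subgraphOf]

theorem Configuration.simple_of_cycleSets_eq_empty (M : d.Configuration)
    (h1 : cycleSets (Sigma.fst : d.HalfEdge → Fin n) M.1 1 = ∅)
    (h2 : cycleSets (Sigma.fst : d.HalfEdge → Fin n) M.1 2 = ∅) : M.multigraph.Simple := by
  have hloop : ∀ a b : d.HalfEdge, s(a, b) ∈ M.1 → a.1 ≠ b.1 := by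
    intro a b he hab
    have hne : b ≠ a := by
      rintro rfl
      exact M.isPairing.1 _ he rfl
    refine Finset.notMem_empty {s(a, b)} (h1 ▸ mem_cycleSets.2
      ⟨by simpa using he, fun _ => ⟨(b, a), hne, hab.symm⟩, fun _ _ _ => Subsingleton.elim _ _, ?_⟩)
    simp [links, linkEdge]
  have hlink : ∀ e u v, M.multigraph.IsLink e u v →
      ∃ a b : d.HalfEdge, e = s(a, b) ∧ a.1 = u ∧ b.1 = v := by
    rintro e u v ⟨he, h⟩
    induction e with
    | h a b =>
      rw [Sym2.map_mk, Sym2.eq_iff] at h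
      rcases h with h | h
      · exact ⟨a, b, rfl, h.1, h.2⟩
      · exact ⟨b, a, Sym2.eq_swap, h.2, h.1⟩
  refine { not_isLoopAt := fun e x h => ?_, eq_of_isLink := fun e f u v he hf => ?_ }
  · obtain ⟨a, b, rfl, ha, hb⟩ := hlink e x x h
    exact hloop a b h.1 (ha.trans hb.symm)
  · obtain ⟨a, b, rfl, ha, hb⟩ := hlink e u v he
    obtain ⟨a', b', rfl, ha', hb'⟩ := hlink f u v hf
    by_contra hef
    have haa : a' ≠ a := by
      rintro rfl
      exact hef (M.isPairing.eq_of_mem he.1 hf.1 (Sym2.mem_mk_left _ _) (Sym2.mem_mk_left _ _))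
    have hbb : b ≠ b' := by
      rintro rfl
      exact hef (M.isPairing.eq_of_mem he.1 hf.1 (Sym2.mem_mk_right _ _) (Sym2.mem_mk_right _ _))
    have huv : u ≠ v := fun h => hloop a b he.1 (ha.trans (h.trans hb.symm))
    -- The 2-cycle leaves `u` by the edge `s(a, b)` and returns from `v` by `s(a', b')`.
    let c : Fin 2 → Transit (Sigma.fst : d.HalfEdge → Fin n) :=
      ![⟨(a', a), haa, ha'.trans ha.symm⟩, ⟨(b, b'), hbb, hb.trans hb'.symm⟩]
    have hc0 : (c 0).vertex = u := ha'
    have hc1 : (c 1).vertex = v := hb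
    have hc : VertexInjective c := by
      intro i j hij
      fin_cases i <;> fin_cases j
      · rfl
      · exact absurd (hc0.symm.trans (hij.trans hc1)) huv
      · exact absurd (hc0.symm.trans (hij.symm.trans hc1)) huv
      · rfl
    refine Finset.notMem_empty (links (finRotate 2) c) (h2 ▸ mem_cycleSets.2 ⟨?_, c, hc, rfl⟩)
    intro g hg
    obtain ⟨i, rfl⟩ := mem_links.1 hg
    fin_cases i
    · exact he.1
    · have := hf.1
      rw [Sym2.eq_swap] at this
      exact this

theorem Configuration.simple_iff (M : d.Configuration) :
    M.multigraph.Simple ↔ M.multigraph.cycleCount 1 = 0 ∧ M.multigraph.cycleCount 2 = 0 := by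
  rw [cycleCount_eq_card, cycleCount_eq_card, Finset.card_eq_zero, Finset.card_eq_zero]
  refine ⟨fun h => ⟨?_, ?_⟩, fun h => M.simple_of_cycleSets_eq_empty h.1 h.2⟩
  · refine Finset.eq_empty_of_forall_notMem fun E hE => ?_
    obtain ⟨hEM, c, hc, rfl⟩ := mem_cycleSets.1 hE
    refine h.not_isLoopAt (linkEdge (finRotate 1) c 0) (c 0).vertex ?_
    refine ⟨hEM (linkEdge_mem_links _ _ _), ?_⟩
    exact congrArg₂ (fun a b => s(a, b)) (c 0).vertex_out rfl
  · refine Finset.eq_empty_of_forall_notMem fun E hE => ?_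
    obtain ⟨hEM, c, hc, rfl⟩ := mem_cycleSets.1 hE
    have h0 : M.multigraph.IsLink (linkEdge (finRotate 2) c 0) (c 0).vertex (c 1).vertex :=
      ⟨hEM (linkEdge_mem_links _ _ _), congrArg₂ (fun a b => s(a, b)) (c 0).vertex_out rfl⟩
    have h1 : M.multigraph.IsLink (linkEdge (finRotate 2) c 1) (c 1).vertex (c 0).vertex :=
      ⟨hEM (linkEdge_mem_links _ _ _), congrArg₂ (fun a b => s(a, b)) (c 1).vertex_out rfl⟩
    have := hc.linkEdge_injective (h.eq_of_isLink h0 h1.symm)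
    exact absurd this (by decide)

end DegreeSequence

/-- Choose an ordered tuple of distinct values in `C`, then one of the `b` preimages of each value.
-/
theorem card_injective_families {A E : Type*} [Fintype A] [DecidableEq E] (g : A → E)
    (P : A → Prop) (C : Finset E) (b r : ℕ) (h₁ : ∀ a, P a → g a ∈ C)
    (h₂ : ∀ e ∈ C, Nat.card {a // P a ∧ g a = e} = b) :
    Nat.card {f : Fin r → A // (∀ s, P (f s)) ∧ Function.Injective fun s => g (f s)} =
      b ^ r * C.card.descFactorial r := by
  classical
  let T := Σ φ : Fin r ↪ C, ∀ s, {a // P a ∧ g a = φ s}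
  let F : T → {f : Fin r → A // (∀ s, P (f s)) ∧ Function.Injective fun s => g (f s)} :=
    fun t => ⟨fun s => (t.2 s).1, fun s => (t.2 s).2.1, fun s s' h => t.1.injective
      (Subtype.ext ((t.2 s).2.2.symm.trans (h.trans (t.2 s').2.2)))⟩
  have hF : Function.Bijective F := by
    constructor
    · rintro ⟨φ, a⟩ ⟨φ', a'⟩ h
      have h' : ∀ s, (a s).1 = (a' s).1 := fun s => congrFun (congrArg Subtype.val h) s
      have hφ : φ = φ' := by
        ext s
        rw [← (a s).2.2, h', (a' s).2.2]
      subst hφ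
      congr 1
      funext s
      exact Subtype.ext (h' s)
    · rintro ⟨f, hf, hg⟩
      exact ⟨⟨⟨fun s => ⟨g (f s), h₁ _ (hf s)⟩, fun s s' h => hg (congrArg Subtype.val h)⟩,
        fun s => ⟨f s, hf s, rfl⟩⟩, rfl⟩
  rw [← Nat.card_eq_of_bijective F hF, Nat.card_eq_fintype_card, Fintype.card_sigma]
  have : ∀ φ : Fin r ↪ C, Fintype.card (∀ s, {a // P a ∧ g a = φ s}) = b ^ r := by
    intro φ
    rw [Fintype.card_pi, Finset.prod_congr rfl fun s _ => ?_, Finset.prod_const, Finset.card_univ,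
      Fintype.card_fin]
    rw [← Nat.card_eq_fintype_card]
    exact h₂ _ (φ s).2
  rw [Finset.sum_congr rfl fun φ _ => this φ, Finset.sum_const, Finset.card_univ,
    Fintype.card_embedding_eq]
  simp [mul_comm]

/-! ### Isolated cycles, families of them, and comparison with vertex-disjoint systems. -/

section Families

variable {H V ι : Type*} [DecidableEq H]

/-- Index set for the passages of a family of cycles with `r i` members of length `k i`. -/
abbrev FamilyIndex (k r : ι → ℕ) : Type _ := Σ j : (Σ i, Fin (r i)), Fin (k j.1)

theorem card_familyIndex [Fintype ι] (k r : ι → ℕ) :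
    Fintype.card (FamilyIndex k r) = ∑ i, r i * k i := by
  simp [FamilyIndex, Fintype.sum_sigma]

/-- The permutation that rotates each cycle of a family. -/
abbrev familyRotate (k r : ι → ℕ) : Equiv.Perm (FamilyIndex k r) :=
  Equiv.sigmaCongrRight fun j => finRotate (k j.1)

theorem links_family_subset_iff {p : H → V} [Fintype ι] {k r : ι → ℕ}
    {c : FamilyIndex k r → Transit p} {M : Finset (Sym2 H)} :
    links (familyRotate k r) c ⊆ M ↔
      ∀ i s, links (finRotate (k i)) (fun x => c ⟨⟨i, s⟩, x⟩) ⊆ M := by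
  rw [familyRotate, links_sigma, Finset.biUnion_subset]
  exact ⟨fun h i s => h ⟨i, s⟩ (Finset.mem_univ _), fun h j _ => h j.1 j.2⟩

variable [Fintype H]

open Classical in
/-- The cycles of length `k i` that are vertex-disjoint from all other cycles whose length occurs
in the family `k`. -/
noncomputable def isolatedSets (p : H → V) (M : Finset (Sym2 H)) (k : ι → ℕ) (i : ι) :
    Finset (Finset (Sym2 H)) :=
  (cycleSets p M (k i)).filter fun E =>
    ∀ i', ∀ F ∈ cycleSets p M (k i'), F ≠ E → ¬ Touches p E F

theorem mem_isolatedSets {p : H → V} {M : Finset (Sym2 H)} {k : ι → ℕ} {i : ι}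
    {E : Finset (Sym2 H)} : E ∈ isolatedSets p M k i ↔ E ∈ cycleSets p M (k i) ∧
      ∀ i', ∀ F ∈ cycleSets p M (k i'), F ≠ E → ¬ Touches p E F := by
  simp [isolatedSets]

/-- A family of distinct isolated cycles. -/
structure IsIsolatedFamily {p : H → V} (M : Finset (Sym2 H)) (k r : ι → ℕ)
    (c : FamilyIndex k r → Transit p) : Prop where
  vertexInjective : ∀ i s, VertexInjective fun x => c ⟨⟨i, s⟩, x⟩
  mem : ∀ i s, links (finRotate (k i)) (fun x => c ⟨⟨i, s⟩, x⟩) ∈ isolatedSets p M k i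
  injective : ∀ i, Function.Injective fun s => links (finRotate (k i)) fun x => c ⟨⟨i, s⟩, x⟩

theorem card_isIsolatedFamily [Fintype ι] (p : H → V) (M : Finset (Sym2 H)) {k : ι → ℕ}
    (hk : ∀ i, 1 ≤ k i) (r : ι → ℕ) :
    Nat.card {c : FamilyIndex k r → Transit p // IsIsolatedFamily M k r c} =
      ∏ i, (2 * k i) ^ r i * (isolatedSets p M k i).card.descFactorial (r i) := by
  classical
  let P : ∀ i, (Fin (k i) → Transit p) → Prop := fun i c =>
    VertexInjective c ∧ links (finRotate (k i)) c ∈ isolatedSets p M k i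
  let Q : ∀ i, (Fin (r i) → Fin (k i) → Transit p) → Prop := fun i f =>
    (∀ s, P i (f s)) ∧ Function.Injective fun s => links (finRotate (k i)) (f s)
  let e₁ : (FamilyIndex k r → Transit p) ≃ ∀ i, Fin (r i) → Fin (k i) → Transit p :=
    (Equiv.piCurry fun (j : Σ i, Fin (r i)) (_ : Fin (k j.1)) => Transit p).trans
      (Equiv.piCurry fun i (_ : Fin (r i)) => Fin (k i) → Transit p)
  have he : ∀ c, IsIsolatedFamily M k r c ↔ ∀ i, Q i (e₁ c i) := fun c =>
    ⟨fun h i => ⟨fun s => ⟨h.vertexInjective i s, h.mem i s⟩, h.injective i⟩,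
      fun h => ⟨fun i s => ((h i).1 s).1, fun i s => ((h i).1 s).2, fun i => (h i).2⟩⟩
  rw [Nat.card_congr ((e₁.subtypeEquiv he).trans Equiv.subtypePiEquivPi), Nat.card_pi]
  refine Finset.prod_congr rfl fun i _ => ?_
  refine card_injective_families _ _ _ _ _ (fun c hc => hc.2) fun E hE => ?_
  obtain ⟨-, c, hc, rfl⟩ := mem_cycleSets.1 (mem_isolatedSets.1 hE).1
  rw [← card_fibre_links (hk i) hc, Nat.card_eq_fintype_card, Fintype.card_subtype]
  congr 1
  ext c'
  simp only [P, Finset.mem_filter, Finset.mem_univ, true_and]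
  exact ⟨fun h => ⟨h.1.1, h.2⟩, fun h => ⟨⟨h.1, h.2 ▸ hE⟩, h.2⟩⟩

/-- Isolated cycles that share a vertex have the same edges, hence the same length. As `k` is
injective and the cycles of one length are distinct, they are the same member of the family. -/
theorem IsIsolatedFamily.vertexInjective_family {p : H → V} {M : Finset (Sym2 H)} {k r : ι → ℕ}
    {c : FamilyIndex k r → Transit p} (hc : IsIsolatedFamily M k r c)
    (hk : Function.Injective k) : VertexInjective c := by
  rintro ⟨⟨i, s⟩, x⟩ ⟨⟨i', s'⟩, x'⟩ h
  have hl : links (finRotate (k i')) (fun x => c ⟨⟨i', s'⟩, x⟩) =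
      links (finRotate (k i)) (fun x => c ⟨⟨i, s⟩, x⟩) := by
    by_contra hne
    exact (mem_isolatedSets.1 (hc.mem i s)).2 i' _ (mem_isolatedSets.1 (hc.mem i' s')).1 hne
      (touches_links_iff.2 ⟨x, x', h⟩)
  have hi : i = i' := by
    have := congrArg Finset.card hl
    rw [(hc.vertexInjective i s).card_links, (hc.vertexInjective i' s').card_links,
      Fintype.card_fin, Fintype.card_fin] at this
    exact hk this.symm
  subst hi
  have hs : s' = s := hc.injective i hl
  subst hs
  have hx : x = x' := hc.vertexInjective i s' h
  rw [hx]

theorem IsIsolatedFamily.links_subset [Fintype ι] {p : H → V} {M : Finset (Sym2 H)} {k r : ι → ℕ}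
    {c : FamilyIndex k r → Transit p} (hc : IsIsolatedFamily M k r c) :
    links (familyRotate k r) c ⊆ M :=
  links_family_subset_iff.2 fun i s => (mem_cycleSets.1 (mem_isolatedSets.1 (hc.mem i s)).1).1

theorem VertexInjective.isIsolatedFamily_or_exists_isEar [Fintype ι] {p : H → V}
    {M : Finset (Sym2 H)} {k r : ι → ℕ} (hk : ∀ i, 1 ≤ k i) {c : FamilyIndex k r → Transit p}
    (hc : VertexInjective c) (hM : links (familyRotate k r) c ⊆ M) :
    IsIsolatedFamily M k r c ∨ ∃ l < ∑ i, k i, ∃ x : (Fin l → Transit p) × H × H,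
      IsEar M (familyRotate k r) c x := by
  by_cases hear : ∃ l < ∑ i, k i, ∃ x : (Fin l → Transit p) × H × H,
      IsEar M (familyRotate k r) c x
  · exact Or.inr hear
  refine Or.inl ?_
  have hmk : ∀ i (s : Fin (r i)),
      Function.Injective fun x : Fin (k i) => (⟨⟨i, s⟩, x⟩ : FamilyIndex k r) := fun i s =>
    sigma_mk_injective (β := fun j : Σ i, Fin (r i) => Fin (k j.1)) (i := ⟨i, s⟩)
  have hv : ∀ i s, VertexInjective fun x => c ⟨⟨i, s⟩, x⟩ := fun i s x y h => hmk i s (hc h)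
  refine ⟨hv, fun i s => ?_, fun i s s' h => ?_⟩
  · rw [mem_isolatedSets]
    refine ⟨mem_cycleSets.2 ⟨links_family_subset_iff.1 hM i s, _, hv i s, rfl⟩, ?_⟩
    intro i' F hF hne ht
    obtain ⟨hFM, c', hc', rfl⟩ := mem_cycleSets.1 hF
    obtain ⟨x, y, hxy⟩ := touches_links_iff.1 ht
    -- A cycle that touches a member either stays within the edges of the family, and then equals
    -- that member, or leaves them and produces an ear.
    by_cases hsub : links (finRotate (k i')) c' ⊆ links (familyRotate k r) c
    · have hxy' : (c' y).vertex = (c ⟨⟨i, s⟩, x⟩).vertex := hxy.symm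
      exact hne (VertexInjective.links_eq_of_subset (K := fun j : Σ i, Fin (r i) => Fin (k j.1))
        (c := c) (j := ⟨i, s⟩) (x := x) (y := y) (σ' := finRotate (k i')) (c' := c')
        (τ := fun j => finRotate (k j.1)) hc
        (fun j => isTransitivePerm_finRotate _) (isTransitivePerm_finRotate _) hsub hxy')
    · obtain ⟨l, hl, x, hx⟩ := exists_isEar hc' hFM ⟨y, ⟨⟨i, s⟩, x⟩, hxy.symm⟩ hsub
      exact hear ⟨l, hl.trans_le (Finset.single_le_sum (fun _ _ => Nat.zero_le _)
        (Finset.mem_univ i')), x, hx⟩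
  · have he := linkEdge_mem_links (finRotate (k i)) (fun x => c ⟨⟨i, s⟩, x⟩) ⟨0, hk i⟩
    rw [show links (finRotate (k i)) (fun x => c ⟨⟨i, s⟩, x⟩) = _ from h] at he
    obtain ⟨x', hx'⟩ := mem_links.1 he
    rw [← linkEdge_sigma (fun j : Σ i, Fin (r i) => finRotate (k j.1)) c ⟨i, s⟩,
      ← linkEdge_sigma (fun j : Σ i, Fin (r i) => finRotate (k j.1)) c ⟨i, s'⟩] at hx'
    have := congrArg Sigma.fst (hc.linkEdge_injective hx')
    exact (by simpa using this : s' = s).symm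

open Classical in
/-- The systems of vertex-disjoint cycles in `M` of the shape described by `σ`. -/
noncomputable def disjointCircuits {I : Type*} [Fintype I] (p : H → V) (M : Finset (Sym2 H))
    (σ : Equiv.Perm I) : Finset (I → Transit p) :=
  Finset.univ.filter fun c => VertexInjective c ∧ links σ c ⊆ M

theorem mem_disjointCircuits {I : Type*} [Fintype I] {p : H → V} {M : Finset (Sym2 H)}
    {σ : Equiv.Perm I} {c : I → Transit p} :
    c ∈ disjointCircuits p M σ ↔ VertexInjective c ∧ links σ c ⊆ M := by
  simp [disjointCircuits]

open Classical in
/-- The systems of vertex-disjoint cycles in `M` of the shape described by `σ`, together with an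
ear with `l` passages. -/
noncomputable def earedCircuits {I : Type*} [Fintype I] (p : H → V) (M : Finset (Sym2 H))
    (σ : Equiv.Perm I) (l : ℕ) : Finset ((I → Transit p) × (Fin l → Transit p) × H × H) :=
  Finset.univ.filter fun x => x.1 ∈ disjointCircuits p M σ ∧ IsEar M σ x.1 x.2

theorem mem_earedCircuits {I : Type*} [Fintype I] {p : H → V} {M : Finset (Sym2 H)}
    {σ : Equiv.Perm I} {l : ℕ} {x : (I → Transit p) × (Fin l → Transit p) × H × H} :
    x ∈ earedCircuits p M σ l ↔ x.1 ∈ disjointCircuits p M σ ∧ IsEar M σ x.1 x.2 := by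
  simp [earedCircuits]

/-- If some cycle is not isolated, then some cycle has an ear. -/
theorem exists_earedCircuits_nonempty [Fintype ι] {p : H → V} {M : Finset (Sym2 H)} {k : ι → ℕ}
    {i : ι} (h : isolatedSets p M k i ≠ cycleSets p M (k i)) :
    ∃ l < ∑ i, k i, (earedCircuits p M (finRotate (k i)) l).Nonempty := by
  obtain ⟨E, hE, hE'⟩ : ∃ E ∈ cycleSets p M (k i), E ∉ isolatedSets p M k i := by
    by_contra! hno
    exact h (Finset.Subset.antisymm (fun E hE => (mem_isolatedSets.1 hE).1) hno)
  simp only [mem_isolatedSets, hE, true_and, not_forall, not_not] at hE'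
  obtain ⟨i', F, hF, hne, ht⟩ := hE'
  obtain ⟨hM, c, hc, rfl⟩ := mem_cycleSets.1 hE
  obtain ⟨hFM, c', hc', rfl⟩ := mem_cycleSets.1 hF
  obtain ⟨x, y, hxy⟩ := touches_links_iff.1 ht
  by_cases hsub : links (finRotate (k i')) c' ⊆ links (finRotate (k i)) c
  · refine absurd ?_ hne
    -- The single cycle is viewed as a family indexed by `Unit`, so that `links_eq_of_subset`
    -- applies.
    have hcU : VertexInjective fun z : Σ _ : Unit, Fin (k i) => c z.2 :=
      hc.comp (f := fun z : Σ _ : Unit, Fin (k i) => z.2) fun z z' h => Sigma.ext rfl (heq_of_eq h)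
    exact hcU.links_eq_of_subset (j := ()) (τ := fun _ => finRotate (k i)) (x := x) (y := y)
      (fun _ => isTransitivePerm_finRotate _) (isTransitivePerm_finRotate _)
      (by simpa [links_sigma] using hsub) hxy.symm
  · obtain ⟨l, hl, w, hw⟩ := exists_isEar hc' hFM ⟨y, x, hxy.symm⟩ hsub
    exact ⟨l, hl.trans_le (Finset.single_le_sum (fun _ _ => Nat.zero_le _) (Finset.mem_univ i')),
      (c, w), mem_earedCircuits.2 ⟨mem_disjointCircuits.2 ⟨hc, hM⟩, hw⟩⟩

/-- With `card_disjointCircuits_le` this brackets the weighted product of falling factorials for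
each matching; the two bounds differ only by eared systems. -/
theorem prod_descFactorial_le [Fintype ι] (p : H → V) (M : Finset (Sym2 H)) {k : ι → ℕ}
    (hk : ∀ i, 1 ≤ k i) (hk' : Function.Injective k) (r : ι → ℕ) :
    ∏ i, (2 * k i) ^ r i * (isolatedSets p M k i).card.descFactorial (r i) ≤
      (disjointCircuits p M (familyRotate k r)).card := by
  classical
  rw [← card_isIsolatedFamily p M hk, Nat.card_eq_fintype_card, Fintype.card_subtype]
  refine Finset.card_le_card fun c hc => ?_
  rw [Finset.mem_filter] at hc
  rw [mem_disjointCircuits]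
  exact ⟨hc.2.vertexInjective_family hk', hc.2.links_subset⟩

theorem card_disjointCircuits_le [Fintype ι] (p : H → V) (M : Finset (Sym2 H)) {k : ι → ℕ}
    (hk : ∀ i, 1 ≤ k i) (r : ι → ℕ) :
    (disjointCircuits p M (familyRotate k r)).card ≤
      ∏ i, (2 * k i) ^ r i * (isolatedSets p M k i).card.descFactorial (r i) +
        ∑ l ∈ Finset.range (∑ i, k i), (earedCircuits p M (familyRotate k r) l).card := by
  classical
  rw [← card_isIsolatedFamily p M hk, Nat.card_eq_fintype_card, Fintype.card_subtype]
  have hsub : disjointCircuits p M (familyRotate k r) ⊆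
      (Finset.univ.filter fun c => IsIsolatedFamily M k r c) ∪
      (Finset.range (∑ i, k i)).biUnion fun l => (earedCircuits p M (familyRotate k r) l).image Prod.fst := by
    intro c hc
    have hc' := hc
    rw [mem_disjointCircuits] at hc'
    simp only [Finset.mem_union, Finset.mem_filter, Finset.mem_univ, true_and, Finset.mem_biUnion,
      Finset.mem_range, Finset.mem_image]
    rcases hc'.1.isIsolatedFamily_or_exists_isEar hk hc'.2 with h | ⟨l, hl, x, hx⟩
    · exact Or.inl h
    · exact Or.inr ⟨l, hl, (c, x), mem_earedCircuits.2 ⟨hc, hx⟩, rfl⟩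
  refine (Finset.card_le_card hsub).trans ((Finset.card_union_le _ _).trans ?_)
  gcongr
  exact Finset.card_biUnion_le.trans (Finset.sum_le_sum fun l _ => Finset.card_image_le)

end Families

/-! ### Double counting of matchings against systems of passages. -/

section Counting

variable {H V : Type*} [Fintype H]

theorem card_transit_vertex_le (p : H → V) [DecidableEq V] [Fintype (Transit p)] (Δ : ℕ)
    (hΔ : ∀ v, Nat.card {h // p h = v} ≤ Δ) (v : V) :
    (Finset.univ.filter fun t : Transit p => t.vertex = v).card ≤ Δ ^ 2 := by
  classical
  have hΔ' : (Finset.univ.filter fun h => p h = v).card ≤ Δ := by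
    refine le_trans (le_of_eq ?_) (hΔ v)
    rw [Nat.card_eq_fintype_card, Fintype.card_subtype]
  calc _ ≤ ((Finset.univ.filter fun h => p h = v) ×ˢ (Finset.univ.filter fun h => p h = v)).card :=
        Finset.card_le_card_of_injOn (fun t => t.1)
          (fun t ht => by
            have ht : Transit.vertex t = v := (Finset.mem_filter.1 ht).2
            simpa using ⟨ht, (Transit.vertex_out t).trans ht⟩)
          (fun t _ u _ h => Subtype.ext h)
    _ ≤ Δ ^ 2 := by
        rw [Finset.card_product, sq]
        exact Nat.mul_le_mul hΔ' hΔ'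

variable [DecidableEq H] {I : Type*} [Fintype I]

/-- The product `(m - 1) (m - 3) ⋯ (m - 2 s + 1)`, so that `s` given disjoint pairs among `m`
half-edges are matched with probability `1 / oddFactorial m s`. -/
def oddFactorial (m s : ℕ) : ℕ := ∏ i ∈ Finset.range s, (m - 1 - 2 * i)

open Classical in
/-- The vertex-injective systems of passages. -/
noncomputable def injectiveTransits (p : H → V) (I : Type*) [Fintype I] :
    Finset (I → Transit p) :=
  Finset.univ.filter VertexInjective

theorem mem_injectiveTransits {p : H → V} {c : I → Transit p} :
    c ∈ injectiveTransits p I ↔ VertexInjective c := by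
  simp [injectiveTransits]

theorem sum_card_disjointCircuits (p : H → V) (σ : Equiv.Perm I) :
    (∑ M ∈ pairingsContaining (∅ : Finset (Sym2 H)), (disjointCircuits p M σ).card) *
      oddFactorial (Fintype.card H) (Fintype.card I) =
    (injectiveTransits p I).card * (pairingsContaining (∅ : Finset (Sym2 H))).card := by
  classical
  have h := Finset.sum_card_bipartiteAbove_eq_sum_card_bipartiteBelow
    (s := pairingsContaining (∅ : Finset (Sym2 H))) (t := injectiveTransits p I)
    fun M c => links σ c ⊆ M
  have h1 : ∀ M, Finset.bipartiteAbove (fun M c => links σ c ⊆ M) (injectiveTransits p I) M =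
      disjointCircuits p M σ := by
    intro M
    ext c
    simp [Finset.mem_bipartiteAbove, mem_injectiveTransits, mem_disjointCircuits]
  have h2 : ∀ c : I → Transit p, Finset.bipartiteBelow (fun M c => links σ c ⊆ M)
      (pairingsContaining (∅ : Finset (Sym2 H))) c = pairingsContaining (links σ c) := by
    intro c
    ext M
    simp [Finset.mem_bipartiteBelow, mem_pairingsContaining]
  simp only [h1, h2] at h
  rw [h, Finset.sum_mul, Finset.sum_congr rfl fun c hc => ?_, Finset.sum_const, smul_eq_mul]
  have hc := mem_injectiveTransits.1 hc
  rw [← card_pairingsContaining_mul (hc.isPartialPairing_links (σ := σ)), hc.card_links,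
    oddFactorial]

open Classical in
/-- The vertex-injective systems of passages together with a walk with `l` passages between two of
their vertices. -/
noncomputable def injectiveTransitsWithWalk (p : H → V) (I : Type*) [Fintype I] (l : ℕ) :
    Finset ((I → Transit p) × (Fin l → Transit p) × H × H) :=
  Finset.univ.filter fun x => VertexInjective x.1 ∧ (∃ y, p x.2.2.1 = (x.1 y).vertex) ∧
    ∃ y, p x.2.2.2 = (x.1 y).vertex

theorem mem_injectiveTransitsWithWalk {p : H → V} {l : ℕ}
    {x : (I → Transit p) × (Fin l → Transit p) × H × H} :
    x ∈ injectiveTransitsWithWalk p I l ↔ VertexInjective x.1 ∧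
      (∃ y, p x.2.2.1 = (x.1 y).vertex) ∧ ∃ y, p x.2.2.2 = (x.1 y).vertex := by
  simp [injectiveTransitsWithWalk]

theorem sum_card_earedCircuits_le (p : H → V) (σ : Equiv.Perm I) (l : ℕ) :
    (∑ M ∈ pairingsContaining (∅ : Finset (Sym2 H)), (earedCircuits p M σ l).card) *
      oddFactorial (Fintype.card H) (Fintype.card I + (l + 1)) ≤
    (injectiveTransitsWithWalk p I l).card *
      (pairingsContaining (∅ : Finset (Sym2 H))).card := by
  classical
  let r : Finset (Sym2 H) → (I → Transit p) × (Fin l → Transit p) × H × H → Prop :=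
    fun M x => x ∈ earedCircuits p M σ l
  have h := Finset.sum_card_bipartiteAbove_eq_sum_card_bipartiteBelow
    (s := pairingsContaining (∅ : Finset (Sym2 H))) (t := injectiveTransitsWithWalk p I l) r
  have h1 : ∀ M, Finset.bipartiteAbove r (injectiveTransitsWithWalk p I l) M =
      earedCircuits p M σ l := by
    intro M
    ext x
    rw [Finset.mem_bipartiteAbove, and_iff_right_iff_imp]
    intro hx
    have hx := mem_earedCircuits.1 hx
    exact mem_injectiveTransitsWithWalk.2
      ⟨(mem_disjointCircuits.1 hx.1).1, hx.2.start, hx.2.finish⟩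
  simp only [h1] at h
  rw [h, Finset.sum_mul]
  refine (Finset.sum_le_card_nsmul _ _ (pairingsContaining (∅ : Finset (Sym2 H))).card
    fun x _ => ?_).trans_eq (smul_eq_mul _ _)
  -- Only here are there exactly `Fintype.card I + (l + 1)` distinct edges to be matched; otherwise
  -- no matching contributes.
  by_cases hinj : VertexInjective x.1 ∧ Function.Injective (walkEdge x.2) ∧
      ∀ i, walkEdge x.2 i ∉ links σ x.1
  · have hcard : (links σ x.1 ∪ Finset.univ.image (walkEdge x.2)).card =
        Fintype.card I + (l + 1) := by
      rw [Finset.card_union_of_disjoint, hinj.1.card_links,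
        Finset.card_image_of_injective _ hinj.2.1, Finset.card_univ, Fintype.card_fin]
      rw [Finset.disjoint_right]
      intro e he
      obtain ⟨i, -, rfl⟩ := Finset.mem_image.1 he
      exact hinj.2.2 i
    have := card_pairingsContaining_mul_le (links σ x.1 ∪ Finset.univ.image (walkEdge x.2))
    rw [hcard] at this
    refine (Nat.mul_le_mul_right _ (Finset.card_le_card fun M hM => ?_)).trans this
    rw [Finset.mem_bipartiteBelow] at hM
    have hx := mem_earedCircuits.1 hM.2
    refine mem_pairingsContaining.2 ⟨(mem_pairingsContaining.1 hM.1).1,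
      Finset.union_subset (mem_disjointCircuits.1 hx.1).2 fun e he => ?_⟩
    obtain ⟨i, -, rfl⟩ := Finset.mem_image.1 he
    exact hx.2.mem i
  · have : Finset.bipartiteBelow r (pairingsContaining (∅ : Finset (Sym2 H))) x = ∅ := by
      refine Finset.eq_empty_of_forall_notMem fun M hM => hinj ?_
      rw [Finset.mem_bipartiteBelow] at hM
      have hx := mem_earedCircuits.1 hM.2
      exact ⟨(mem_disjointCircuits.1 hx.1).1, hx.2.injective, hx.2.notMem⟩
    simp [this]

theorem card_injectiveTransits_le (p : H → V) (I : Type*) [Fintype I]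
    [Fintype (Transit p)] : (injectiveTransits p I).card ≤
      Fintype.card (Transit p) ^ Fintype.card I := by
  classical
  refine (Finset.card_le_univ _).trans_eq ?_
  rw [Fintype.card_fun]

/-- All passages are chosen freely, but each end of the walk is one of at most `Fintype.card I * Δ`
half-edges at vertices of the system. Here an ear loses against a generic configuration. -/
theorem card_injectiveTransitsWithWalk_le (p : H → V) (I : Type*) [Fintype I]
    [Fintype (Transit p)] (l Δ : ℕ) (hΔ : ∀ v, Nat.card {h // p h = v} ≤ Δ) :
    (injectiveTransitsWithWalk p I l).card ≤
      Fintype.card (Transit p) ^ (Fintype.card I + l) * (Fintype.card I * Δ) ^ 2 := by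
  classical
  have hsub : ∀ c : I → Transit p,
      (Finset.univ.filter fun h => ∃ y, p h = (c y).vertex).card ≤ Fintype.card I * Δ := by
    intro c
    have : (Finset.univ.filter fun h => ∃ y, p h = (c y).vertex) =
        Finset.univ.biUnion fun y => Finset.univ.filter fun h => p h = (c y).vertex := by
      ext h; simp
    rw [this]
    refine Finset.card_biUnion_le_card_mul _ _ _ fun y _ => ?_
    refine le_trans (le_of_eq ?_) (hΔ (c y).vertex)
    rw [Nat.card_eq_fintype_card, Fintype.card_subtype]
  have h1 : (injectiveTransitsWithWalk p I l) ⊆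
      (Finset.univ : Finset ((I → Transit p) × (Fin l → Transit p))).biUnion fun ct =>
        ((Finset.univ.filter fun h => ∃ y, p h = (ct.1 y).vertex) ×ˢ
          (Finset.univ.filter fun h => ∃ y, p h = (ct.1 y).vertex)).image
            fun ba => (ct.1, ct.2, ba.1, ba.2) := by
    rintro ⟨c, t, b, a⟩ hx
    obtain ⟨-, hb, ha⟩ := mem_injectiveTransitsWithWalk.1 hx
    simp only [Finset.mem_biUnion, Finset.mem_univ, true_and, Finset.mem_image,
      Finset.mem_product, Finset.mem_filter]
    exact ⟨(c, t), (b, a), ⟨hb, ha⟩, rfl⟩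
  refine (Finset.card_le_card h1).trans ((Finset.card_biUnion_le_card_mul _ _
    ((Fintype.card I * Δ) ^ 2) fun ct _ => ?_).trans_eq ?_)
  · refine Finset.card_image_le.trans ?_
    rw [Finset.card_product, sq]
    exact Nat.mul_le_mul (hsub _) (hsub _)
  · rw [Finset.card_univ, Fintype.card_prod, Fintype.card_fun, Fintype.card_fun, Fintype.card_fin,
      pow_add]

/-- Union bound over pairs of indices: if two passages share a vertex, the second has at most `Δ ^
2` choices once all the others are fixed. -/
theorem le_card_injectiveTransits (p : H → V) (I : Type*) [Fintype I]
    [Fintype (Transit p)] (Δ : ℕ) (hΔ : ∀ v, Nat.card {h // p h = v} ≤ Δ) :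
    Fintype.card (Transit p) ^ Fintype.card I ≤ (injectiveTransits p I).card +
      Fintype.card I ^ 2 * (Δ ^ 2 * Fintype.card (Transit p) ^ (Fintype.card I - 1)) := by
  classical
  set S := Fintype.card (Transit p) with hS
  have hcol : ∀ x y : I, x ≠ y → (Finset.univ.filter fun c : I → Transit p =>
      (c y).vertex = (c x).vertex).card ≤ Δ ^ 2 * S ^ (Fintype.card I - 1) := by
    intro x y hxy
    have himg : Fintype.card ({z // z ≠ y} → Transit p) = S ^ (Fintype.card I - 1) := by
      rw [Fintype.card_fun, Fintype.card_subtype_compl, Fintype.card_subtype_eq]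
    rw [← himg, ← Finset.card_univ]
    refine Finset.card_le_mul_card_image_of_maps_to
      (f := fun c : I → Transit p => fun z : {z // z ≠ y} => c z)
      (fun _ _ => Finset.mem_univ _) _ fun g _ => ?_
    refine le_trans (Finset.card_le_card_of_injOn (fun c => c y) ?_ ?_)
      (card_transit_vertex_le p Δ hΔ (g ⟨x, hxy⟩).vertex)
    · intro c hc
      simp only [Finset.mem_coe, Finset.mem_filter, Finset.mem_univ, true_and] at hc ⊢
      rw [hc.1, ← hc.2]
    · intro c hc c' hc' h
      rw [Finset.mem_coe, Finset.mem_filter] at hc hc'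
      funext z
      by_cases hz : z = y
      · rw [hz]; exact h
      · exact congrFun (hc.2.trans hc'.2.symm) ⟨z, hz⟩
  have hsub : (Finset.univ : Finset (I → Transit p)) ⊆ injectiveTransits p I ∪
      (Finset.univ.filter fun z : I × I => z.1 ≠ z.2).biUnion fun z =>
        Finset.univ.filter fun c : I → Transit p => (c z.2).vertex = (c z.1).vertex := by
    intro c _
    by_cases hc : VertexInjective c
    · exact Finset.mem_union_left _ (mem_injectiveTransits.2 hc)
    · refine Finset.mem_union_right _ ?_
      simp only [VertexInjective, Function.Injective, not_forall] at hc
      obtain ⟨x, y, hxy, hne⟩ := hc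
      simp only [Finset.mem_biUnion, Finset.mem_filter, Finset.mem_univ, true_and]
      exact ⟨(x, y), hne, hxy.symm⟩
  calc S ^ Fintype.card I = (Finset.univ : Finset (I → Transit p)).card := by
        rw [Finset.card_univ, Fintype.card_fun]
    _ ≤ _ := (Finset.card_le_card hsub).trans (Finset.card_union_le _ _)
    _ ≤ _ := by
        gcongr
        refine (Finset.card_biUnion_le_card_mul _ _ _ fun z hz => hcol z.1 z.2
          (Finset.mem_filter.1 hz).2).trans ?_
        gcongr
        refine (Finset.card_le_univ _).trans_eq ?_
        rw [Fintype.card_prod, sq]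

end Counting

/-! ### Averages over finite sets. -/

section Average

variable {α : Type*}

/-- The average of `f` over the finite set `s`. -/
noncomputable def finAverage (s : Finset α) (f : α → ℝ) : ℝ := (∑ ω ∈ s, f ω) / s.card

theorem finAverage_mono {s : Finset α} {f g : α → ℝ} (h : ∀ ω ∈ s, f ω ≤ g ω) :
    finAverage s f ≤ finAverage s g :=
  div_le_div_of_nonneg_right (Finset.sum_le_sum h) (Nat.cast_nonneg _)

theorem finAverage_sub (s : Finset α) (f g : α → ℝ) :
    finAverage s (fun ω => f ω - g ω) = finAverage s f - finAverage s g := by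
  simp [finAverage, Finset.sum_sub_distrib, sub_div]

theorem finAverage_const_mul (s : Finset α) (a : ℝ) (f : α → ℝ) :
    finAverage s (fun ω => a * f ω) = a * finAverage s f := by
  rw [finAverage, finAverage, ← Finset.mul_sum, mul_div_assoc]

theorem finAverage_sum {ι : Type*} (s : Finset α) (t : Finset ι) (f : ι → α → ℝ) :
    finAverage s (fun ω => ∑ i ∈ t, f i ω) = ∑ i ∈ t, finAverage s (f i) := by
  simp only [finAverage]
  rw [Finset.sum_comm, Finset.sum_div]

theorem finAverage_const {s : Finset α} (hs : s.Nonempty) (a : ℝ) :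
    finAverage s (fun _ => a) = a := by
  have : (s.card : ℝ) ≠ 0 := Nat.cast_ne_zero.2 hs.card_pos.ne'
  simp [finAverage]
  field_simp

theorem finAverage_sub_const {s : Finset α} (hs : s.Nonempty) (f : α → ℝ) (a : ℝ) :
    finAverage s (fun ω => f ω - a) = finAverage s f - a := by
  rw [finAverage_sub, finAverage_const hs]

theorem finAverage_nonneg {s : Finset α} {f : α → ℝ} (h : ∀ ω ∈ s, 0 ≤ f ω) : 0 ≤ finAverage s f :=
  div_nonneg (Finset.sum_nonneg h) (Nat.cast_nonneg _)

theorem abs_finAverage_le (s : Finset α) (f : α → ℝ) :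
    |finAverage s f| ≤ finAverage s fun ω => |f ω| := by
  rw [finAverage, finAverage, abs_div, Nat.abs_cast]
  exact div_le_div_of_nonneg_right (Finset.abs_sum_le_sum_abs _ _) (Nat.cast_nonneg _)

end Average

/-! ### Bonferroni inequalities. -/

section Bonferroni

/-- The Bonferroni sum with `R` terms for the indicator function of `x = j`. -/
noncomputable def bonferroniSum (j R x : ℕ) : ℝ :=
  ∑ r ∈ Finset.range R, (-1) ^ r * ((j + r).choose j : ℝ) * (x.choose (j + r) : ℝ)

theorem choose_add_mul_choose (j r x : ℕ) :
    (j + r).choose j * x.choose (j + r) = x.choose j * (x - j).choose r := by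
  rcases le_or_gt (j + r) x with h | h
  · have := Nat.choose_mul (n := x) (Nat.le_add_right j r)
    rw [Nat.add_sub_cancel_left] at this
    rw [mul_comm, this]
  · rw [Nat.choose_eq_zero_of_lt h, mul_zero]
    rcases le_or_gt j x with h' | h'
    · rw [Nat.choose_eq_zero_of_lt (show x - j < r by omega), mul_zero]
    · rw [Nat.choose_eq_zero_of_lt h', zero_mul]

/-- After the factor C(x, j) is taken out, the partial alternating sum of the binomial coefficients
C(N + 1, r) over r ≤ R is (-1)^R C(N, R), which is at most the first omitted term C(N + 1, R + 1).
-/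
theorem abs_sub_bonferroniSum_le (j R x : ℕ) :
    |(if x = j then 1 else 0) - bonferroniSum j (R + 1) x| ≤
      ((j + (R + 1)).choose j : ℝ) * (x.choose (j + (R + 1)) : ℝ) := by
  have hsum : bonferroniSum j (R + 1) x =
      x.choose j * ∑ r ∈ Finset.range (R + 1), (-1 : ℝ) ^ r * ((x - j).choose r : ℝ) := by
    rw [bonferroniSum, Finset.mul_sum]
    refine Finset.sum_congr rfl fun r _ => ?_
    rw [mul_assoc, ← Nat.cast_mul, choose_add_mul_choose, Nat.cast_mul]
    ring
  rw [← Nat.cast_mul, choose_add_mul_choose, Nat.cast_mul, hsum]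
  rcases lt_trichotomy x j with h | rfl | h
  · simp [h.ne, Nat.choose_eq_zero_of_lt h]
  · simp [Finset.sum_range_succ']
  · obtain ⟨N, hN⟩ := Nat.exists_eq_add_of_lt h
    have hxj : x - j = N + 1 := by omega
    clear hsum
    have halt : ∑ r ∈ Finset.range (R + 1), (-1 : ℝ) ^ r * ((N + 1).choose r : ℝ) =
        (-1) ^ R * (N.choose R : ℝ) := by
      induction R with
      | zero => simp
      | succ R ih =>
        rw [Finset.sum_range_succ, ih, Nat.choose_succ_succ]
        push_cast
        ring
    rw [if_neg h.ne', hxj, halt, zero_sub, abs_neg, abs_mul, abs_mul, abs_pow, abs_neg, abs_one,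
      one_pow, one_mul, Nat.abs_cast, Nat.abs_cast]
    gcongr
    rw [Nat.choose_succ_succ]
    exact Nat.le_add_right _ _

theorem abs_prod_sub_prod_le {ι : Type*} (s : Finset ι) (f g h : ι → ℝ)
    (hf : ∀ i, |f i| ≤ 1) (hfg : ∀ i, |f i - g i| ≤ h i) :
    |∏ i ∈ s, f i - ∏ i ∈ s, g i| ≤ ∏ i ∈ s, (1 + h i) - 1 := by
  classical
  have hh : ∀ i, 0 ≤ h i := fun i => (abs_nonneg _).trans (hfg i)
  induction s using Finset.induction_on with
  | empty => simp
  | insert a s ha ih =>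
    rw [Finset.prod_insert ha, Finset.prod_insert ha, Finset.prod_insert ha]
    have hga : |g a| ≤ 1 + h a := by
      calc |g a| = |f a - (f a - g a)| := by ring_nf
        _ ≤ |f a| + |f a - g a| := abs_sub _ _
        _ ≤ 1 + h a := add_le_add (hf a) (hfg a)
    have hF : |∏ i ∈ s, f i| ≤ 1 := by
      rw [Finset.abs_prod]
      exact Finset.prod_le_one (fun i _ => abs_nonneg _) fun i _ => hf i
    calc |f a * ∏ i ∈ s, f i - g a * ∏ i ∈ s, g i|
        = |(f a - g a) * ∏ i ∈ s, f i + g a * (∏ i ∈ s, f i - ∏ i ∈ s, g i)| := by ring_nf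
      _ ≤ |f a - g a| * |∏ i ∈ s, f i| + |g a| * |∏ i ∈ s, f i - ∏ i ∈ s, g i| := by
          rw [← abs_mul, ← abs_mul]; exact abs_add_le _ _
      _ ≤ h a * 1 + (1 + h a) * (∏ i ∈ s, (1 + h i) - 1) := by
          have := hh a
          gcongr
          exact hfg a
      _ = (1 + h a) * ∏ i ∈ s, (1 + h i) - 1 := by ring

end Bonferroni

/-! ### From factorial moments to Poisson point probabilities. -/

section PoissonConvergence

variable {α : ℕ → Type*} {s : ∀ n, Finset (α n)} {ι : Type*} [Fintype ι]
  {X : ∀ n, α n → ι → ℕ} {μ : ι → ℝ}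

/-- Expanding the product gives a finite linear combination of joint factorial moments. -/
theorem tendsto_finAverage_prod_sum
    (h : ∀ r : ι → ℕ, Tendsto
      (fun n => finAverage (s n) fun ω => ∏ i, ((X n ω i).descFactorial (r i) : ℝ))
      atTop (nhds (∏ i, μ i ^ r i)))
    (A : Finset ℕ) (a : ι → ℕ → ℝ) (e : ι → ℕ → ℕ) :
    Tendsto (fun n => finAverage (s n) fun ω =>
      ∏ i, ∑ r ∈ A, a i r * ((X n ω i).descFactorial (e i r) : ℝ)) atTop
      (nhds (∏ i, ∑ r ∈ A, a i r * μ i ^ e i r)) := by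
  classical
  simp only [Finset.prod_univ_sum, finAverage_sum, Finset.prod_mul_distrib, finAverage_const_mul]
  exact tendsto_finsetSum _ fun x _ => (h fun i => e i (x i)).const_mul _

/-- Used to let n tend to infinity for a fixed truncation level `R`, and only then `R`. -/
theorem tendsto_of_approx {a : ℕ → ℝ} {u v : ℕ → ℕ → ℝ} {U W : ℕ → ℝ} {L : ℝ}
    (hu : ∀ R, Tendsto (u R) atTop (nhds (U R))) (hv : ∀ R, Tendsto (v R) atTop (nhds (W R)))
    (hauv : ∀ R n, |a n - u R n| ≤ v R n) (hU : Tendsto U atTop (nhds L))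
    (hW : Tendsto W atTop (nhds 0)) : Tendsto a atTop (nhds L) := by
  rw [Metric.tendsto_nhds]
  intro ε hε
  have h1 := (Metric.tendsto_nhds.1 hU) (ε / 4) (by positivity)
  have h2 := (Metric.tendsto_nhds.1 hW) (ε / 4) (by positivity)
  obtain ⟨R, hR1, hR2⟩ := (h1.and h2).exists
  filter_upwards [(Metric.tendsto_nhds.1 (hu R)) (ε / 4) (by positivity),
    (Metric.tendsto_nhds.1 (hv R)) (ε / 4) (by positivity)] with n hn1 hn2
  have h3 := hauv R n
  rw [Real.dist_eq] at *
  rw [abs_lt] at *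
  rw [abs_le] at h3
  constructor <;> linarith [h3.1, h3.2, hn1.1, hn1.2, hn2.1, hn2.2, hR1.1, hR1.2, hR2.1, hR2.2]

/-- If the joint factorial moments converge to those of independent Poisson variables, then the
joint probability mass function converges to the product of Poisson mass functions. -/
theorem tendsto_finAverage_of_tendsto_factorial_moments (hs : ∀ n, (s n).Nonempty)
    (h : ∀ r : ι → ℕ, Tendsto
      (fun n => finAverage (s n) fun ω => ∏ i, ((X n ω i).descFactorial (r i) : ℝ))
      atTop (nhds (∏ i, μ i ^ r i))) (j : ι → ℕ) [∀ n ω, Decidable (X n ω = j)] :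
    Tendsto (fun n => finAverage (s n) fun ω => if X n ω = j then 1 else 0) atTop
      (nhds (∏ i, (Real.exp (-μ i) * μ i ^ j i / (j i).factorial))) := by
  have hfac : ∀ k : ℕ, ((k.factorial : ℕ) : ℝ) ≠ 0 := fun k =>
    Nat.cast_ne_zero.2 k.factorial_ne_zero
  have hdesc : ∀ x k : ℕ, (x.choose k : ℝ) = (x.descFactorial k : ℝ) / k.factorial := by
    intro x k
    rw [Nat.descFactorial_eq_factorial_mul_choose, Nat.cast_mul]
    field_simp [hfac k]
  have hchoose : ∀ j r : ℕ, ((j + r).choose j : ℝ) / ((j + r).factorial : ℝ) =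
      1 / (j.factorial * r.factorial) := by
    intro j r
    rw [Nat.cast_add_choose]
    have h1 := hfac j
    have h2 := hfac r
    have h3 := hfac (j + r)
    field_simp
  have hcc : ∀ j r x : ℕ, ((j + r).choose j : ℝ) * (x.choose (j + r) : ℝ) =
      1 / (j.factorial * r.factorial) * (x.descFactorial (j + r) : ℝ) := by
    intro j r x
    rw [hdesc x, ← hchoose]
    ring
  let u : ℕ → ℕ → ℝ := fun R n => finAverage (s n) fun ω =>
    ∏ i, ∑ r ∈ Finset.range (R + 1), ((-1) ^ r / ((j i).factorial * r.factorial)) *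
      ((X n ω i).descFactorial (j i + r) : ℝ)
  -- The error bound ∏ (1 + h_i) - 1 from `abs_prod_sub_prod_le`, where h_i is the first omitted
  -- Bonferroni term. Writing 1 + h_i as a sum over `Finset.range 2` lets
  -- `tendsto_finAverage_prod_sum` apply to it too.
  let v : ℕ → ℕ → ℝ := fun R n => (finAverage (s n) fun ω =>
    ∏ i, ∑ r ∈ Finset.range 2, (if r = 0 then 1 else
      1 / (((j i).factorial : ℝ) * (R + 1).factorial)) *
      ((X n ω i).descFactorial (if r = 0 then 0 else j i + (R + 1)) : ℝ)) - 1
  refine tendsto_of_approx (u := u) (v := v) (fun R => tendsto_finAverage_prod_sum h _ _ _)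
    (fun R => (tendsto_finAverage_prod_sum h _ _ _).sub_const 1) ?_ ?_ ?_
  · intro R n
    simp only [u, v]
    rw [← finAverage_sub, ← finAverage_sub_const (hs n)]
    refine (abs_finAverage_le _ _).trans (finAverage_mono fun ω _ => ?_)
    have hprod : (if X n ω = j then 1 else 0 : ℝ) = ∏ i, if X n ω i = j i then 1 else 0 := by
      rw [Finset.prod_ite_zero]
      simp [funext_iff]
    rw [hprod]
    have hb : ∀ i, ∑ r ∈ Finset.range (R + 1), ((-1) ^ r / ((j i).factorial * r.factorial)) *
        ((X n ω i).descFactorial (j i + r) : ℝ) = bonferroniSum (j i) (R + 1) (X n ω i) := by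
      intro i
      refine Finset.sum_congr rfl fun r _ => ?_
      rw [mul_assoc, hcc]
      ring
    have hh : ∀ i, ∑ r ∈ Finset.range 2, (if r = 0 then 1 else
        1 / (((j i).factorial : ℝ) * (R + 1).factorial)) *
        ((X n ω i).descFactorial (if r = 0 then 0 else j i + (R + 1)) : ℝ) =
        1 + ((j i + (R + 1)).choose (j i) : ℝ) * ((X n ω i).choose (j i + (R + 1)) : ℝ) := by
      intro i
      rw [hcc]
      simp [Finset.sum_range_succ]
    simp only [hb, hh]
    refine abs_prod_sub_prod_le _ _ _ _ (fun i => ?_) fun i => abs_sub_bonferroniSum_le _ _ _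
    split_ifs <;> simp
  · refine tendsto_finsetProd _ fun i _ => ?_
    have hexp : Tendsto (fun R => ∑ r ∈ Finset.range (R + 1), (-μ i) ^ r / (r.factorial : ℝ)) atTop
        (nhds (Real.exp (-μ i))) := by
      have := (NormedSpace.expSeries_div_hasSum_exp (-μ i)).tendsto_sum_nat
      rw [← Real.exp_eq_exp_ℝ] at this
      exact this.comp (tendsto_add_atTop_nat 1)
    have := hexp.const_mul (μ i ^ j i / (j i).factorial)
    refine (this.congr fun R => ?_).trans_eq ?_
    · rw [Finset.mul_sum]
      refine Finset.sum_congr rfl fun r _ => ?_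
      rw [neg_pow, pow_add]
      field_simp
    · congr 1
      ring
  · have h0 : ∀ i, Tendsto (fun R => ∑ r ∈ Finset.range 2, (if r = 0 then 1 else
        1 / (((j i).factorial : ℝ) * (R + 1).factorial)) *
        μ i ^ (if r = 0 then 0 else j i + (R + 1))) atTop (nhds 1) := by
      intro i
      have := ((FloorSemiring.tendsto_pow_div_factorial_atTop (μ i)).comp
        (tendsto_add_atTop_nat 1)).const_mul (μ i ^ j i / (j i).factorial)
      have := this.const_add 1
      rw [mul_zero, add_zero] at this
      refine this.congr fun R => ?_
      simp only [Finset.sum_range_succ, Finset.sum_range_zero, Function.comp, pow_add, pow_one]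
      simp
      field_simp
      ring
    have := (tendsto_finsetProd Finset.univ fun i _ => h0 i).sub_const 1
    simpa using this

end PoissonConvergence

/-! ### Asymptotics of the matching probabilities. -/

section OddFactorial

theorem tendsto_natSub_div (c : ℕ) :
    Tendsto (fun m : ℕ => ((m - c : ℕ) : ℝ) / m) atTop (nhds 1) := by
  have h : Tendsto (fun m : ℕ => 1 - (c : ℝ) / m) atTop (nhds (1 - 0)) :=
    (tendsto_const_div_atTop_nhds_zero_nat (c : ℝ)).const_sub 1
  rw [sub_zero] at h
  refine h.congr' ?_
  filter_upwards [eventually_ge_atTop c, eventually_gt_atTop 0] with m hm hm0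
  have : (m : ℝ) ≠ 0 := Nat.cast_ne_zero.2 hm0.ne'
  rw [Nat.cast_sub hm]
  field_simp

variable {m : ℕ → ℕ}

theorem tendsto_oddFactorial_div (hm : Tendsto m atTop atTop) (s : ℕ) :
    Tendsto (fun n => (oddFactorial (m n) s : ℝ) / (m n : ℝ) ^ s) atTop (nhds 1) := by
  have h : Tendsto (fun n => ∏ i ∈ Finset.range s, ((m n - (1 + 2 * i) : ℕ) : ℝ) / (m n : ℝ)) atTop
      (nhds (∏ i ∈ Finset.range s, 1)) :=
    tendsto_finsetProd _ fun i _ => (tendsto_natSub_div (1 + 2 * i)).comp hm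
  simpa [oddFactorial, Finset.prod_div_distrib, Nat.sub_sub] using h

theorem tendsto_div_oddFactorial (hm : Tendsto m atTop atTop) (s : ℕ) {A : ℕ → ℝ} {a : ℝ}
    (hA : Tendsto (fun n => A n / (m n : ℝ) ^ s) atTop (nhds a)) :
    Tendsto (fun n => A n / oddFactorial (m n) s) atTop (nhds a) := by
  have h := hA.div (tendsto_oddFactorial_div hm s) one_ne_zero
  rw [div_one] at h
  refine h.congr' ?_
  filter_upwards [hm.eventually_gt_atTop 0] with n hn
  have : (m n : ℝ) ≠ 0 := Nat.cast_ne_zero.2 hn.ne'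
  exact div_div_div_cancel_right₀ (pow_ne_zero _ this) _ _

theorem eventually_oddFactorial_pos (hm : Tendsto m atTop atTop) (s : ℕ) :
    ∀ᶠ n in atTop, 0 < oddFactorial (m n) s := by
  filter_upwards [hm.eventually_gt_atTop (2 * s)] with n hn
  exact Finset.prod_pos fun i hi => by
    have := Finset.mem_range.1 hi
    omega

end OddFactorial

/-! ### Limits of the cycle counts in the sparse regime. -/

section Asymptotics

/-- The asymptotic regime of the configuration model: there are `m n → ∞` half-edges, at most `Δ n`
of them at each vertex, the number of passages is asymptotic to `ν * m n`, and `Δ n ^ 2` is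
negligible. -/
structure SparseRegime {H V : ℕ → Type*} [∀ n, Fintype (H n)] (p : ∀ n, H n → V n)
    (Δ : ℕ → ℕ) (ν : ℝ) : Prop where
  card_le : ∀ n v, Nat.card {h // p n h = v} ≤ Δ n
  tendsto_card : Tendsto (fun n => Fintype.card (H n)) atTop atTop
  tendsto_transit : Tendsto
    (fun n => (Nat.card (Transit (p n)) : ℝ) / (Fintype.card (H n) : ℝ)) atTop (nhds ν)
  tendsto_max : Tendsto (fun n => (Δ n : ℝ) ^ 2 / (Fintype.card (H n) : ℝ)) atTop (nhds 0)

/-- The average over all perfect matchings of the half-edges. -/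
noncomputable def pairingAverage {H : Type*} [Fintype H] [DecidableEq H]
    (f : Finset (Sym2 H) → ℝ) : ℝ :=
  finAverage (pairingsContaining ∅) f

variable {H V : ℕ → Type*} [∀ n, Fintype (H n)] [∀ n, DecidableEq (H n)]
  {p : ∀ n, H n → V n} {Δ : ℕ → ℕ} {ν : ℝ}

theorem SparseRegime.tendsto_injectiveTransits (h : SparseRegime p Δ ν) (I : Type*) [Fintype I] :
    Tendsto (fun n => ((injectiveTransits (p n) I).card : ℝ) /
      oddFactorial (Fintype.card (H n)) (Fintype.card I)) atTop (nhds (ν ^ Fintype.card I)) := by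
  classical
  refine tendsto_div_oddFactorial h.tendsto_card _ ?_
  set t := Fintype.card I
  have hS := h.tendsto_transit
  simp only [Nat.card_eq_fintype_card] at hS
  have hup : Tendsto (fun n => ((Fintype.card (Transit (p n)) : ℝ) / Fintype.card (H n)) ^ t)
      atTop (nhds (ν ^ t)) := hS.pow t
  have hlow : Tendsto (fun n => ((Fintype.card (Transit (p n)) : ℝ) / Fintype.card (H n)) ^ t -
      (t : ℝ) ^ 2 * (((Δ n : ℝ) ^ 2 / Fintype.card (H n)) *
        ((Fintype.card (Transit (p n)) : ℝ) / Fintype.card (H n)) ^ (t - 1)))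
      atTop (nhds (ν ^ t)) := by
    simpa using hup.sub ((h.tendsto_max.mul (hS.pow (t - 1))).const_mul ((t : ℝ) ^ 2))
  refine tendsto_of_tendsto_of_tendsto_of_le_of_le' hlow hup ?_ ?_
  · filter_upwards [h.tendsto_card.eventually_gt_atTop 0] with n hn
    have hm : (0 : ℝ) < Fintype.card (H n) := Nat.cast_pos.2 hn
    have hle : ((Fintype.card (Transit (p n)) : ℝ)) ^ t ≤ (injectiveTransits (p n) I).card +
        (t : ℝ) ^ 2 * ((Δ n : ℝ) ^ 2 * (Fintype.card (Transit (p n)) : ℝ) ^ (t - 1)) := by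
      exact_mod_cast le_card_injectiveTransits (p n) I (Δ n) (h.card_le n)
    rw [sub_le_iff_le_add, div_pow]
    calc _ ≤ ((injectiveTransits (p n) I).card + (t : ℝ) ^ 2 * ((Δ n : ℝ) ^ 2 *
            (Fintype.card (Transit (p n)) : ℝ) ^ (t - 1))) / (Fintype.card (H n) : ℝ) ^ t := by
          gcongr
      _ = _ := by
          rw [add_div]
          congr 1
          -- For `t = 0` the exponent `t - 1` is truncated, but the factor `t ^ 2` removes that
          -- term.
          rcases Nat.eq_zero_or_pos t with h0 | h0
          · simp [h0]
          · obtain ⟨u, hu⟩ := Nat.exists_eq_add_of_le' h0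
            rw [hu, Nat.succ_eq_add_one, zero_add, Nat.add_sub_cancel, pow_succ, div_pow]
            field_simp
            ring
  · filter_upwards with n
    rw [div_pow]
    gcongr
    exact_mod_cast card_injectiveTransits_le (p n) I

/-- There are `t + l` passages for `t + l + 1` edges, so the ratio is at most (S/m)^(t + l) ·
t²Δ²/m. -/
theorem SparseRegime.tendsto_injectiveTransitsWithWalk (h : SparseRegime p Δ ν) (I : Type*)
    [Fintype I] (l : ℕ) :
    Tendsto (fun n => ((injectiveTransitsWithWalk (p n) I l).card : ℝ) /
      oddFactorial (Fintype.card (H n)) (Fintype.card I + (l + 1))) atTop (nhds 0) := by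
  classical
  refine tendsto_div_oddFactorial h.tendsto_card _ ?_
  set t := Fintype.card I
  have hS := h.tendsto_transit
  simp only [Nat.card_eq_fintype_card] at hS
  have hup : Tendsto (fun n => ((Fintype.card (Transit (p n)) : ℝ) / Fintype.card (H n)) ^ (t + l) *
      ((t : ℝ) ^ 2 * ((Δ n : ℝ) ^ 2 / Fintype.card (H n)))) atTop (nhds 0) := by
    simpa using (hS.pow (t + l)).mul (h.tendsto_max.const_mul ((t : ℝ) ^ 2))
  refine tendsto_of_tendsto_of_tendsto_of_le_of_le' tendsto_const_nhds hup ?_ ?_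
  · filter_upwards with n
    positivity
  · filter_upwards with n
    have hle : ((injectiveTransitsWithWalk (p n) I l).card : ℝ) ≤
        (Fintype.card (Transit (p n)) : ℝ) ^ (t + l) * ((t : ℝ) * (Δ n : ℝ)) ^ 2 := by
      exact_mod_cast card_injectiveTransitsWithWalk_le (p n) I l (Δ n) (h.card_le n)
    calc _ ≤ ((Fintype.card (Transit (p n)) : ℝ) ^ (t + l) * ((t : ℝ) * (Δ n : ℝ)) ^ 2) /
            (Fintype.card (H n) : ℝ) ^ (t + (l + 1)) := by gcongr
      _ = _ := by
          rw [← add_assoc, pow_succ _ (t + l), div_pow, mul_pow, ← mul_div_assoc,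
            div_mul_div_comm]

theorem SparseRegime.tendsto_average_disjointCircuits (h : SparseRegime p Δ ν)
    (hne : ∀ n, (pairingsContaining (∅ : Finset (Sym2 (H n)))).Nonempty) {I : Type*}
    [Fintype I] (σ : Equiv.Perm I) :
    Tendsto (fun n => pairingAverage fun M => ((disjointCircuits (p n) M σ).card : ℝ)) atTop
      (nhds (ν ^ Fintype.card I)) := by
  refine (h.tendsto_injectiveTransits I).congr' ?_
  filter_upwards [eventually_oddFactorial_pos h.tendsto_card (Fintype.card I)] with n hn
  have hT : (0 : ℝ) < (pairingsContaining (∅ : Finset (Sym2 (H n)))).card :=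
    Nat.cast_pos.2 (hne n).card_pos
  have hO : (0 : ℝ) < oddFactorial (Fintype.card (H n)) (Fintype.card I) := Nat.cast_pos.2 hn
  rw [pairingAverage, finAverage, div_eq_div_iff hO.ne' hT.ne']
  exact_mod_cast (sum_card_disjointCircuits (p n) σ).symm

theorem SparseRegime.tendsto_average_earedCircuits (h : SparseRegime p Δ ν)
    (hne : ∀ n, (pairingsContaining (∅ : Finset (Sym2 (H n)))).Nonempty) {I : Type*}
    [Fintype I] (σ : Equiv.Perm I) (l : ℕ) :
    Tendsto (fun n => pairingAverage fun M => ((earedCircuits (p n) M σ l).card : ℝ)) atTop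
      (nhds 0) := by
  refine tendsto_of_tendsto_of_tendsto_of_le_of_le' tendsto_const_nhds
    (h.tendsto_injectiveTransitsWithWalk I l) ?_ ?_
  · filter_upwards with n
    exact finAverage_nonneg fun _ _ => Nat.cast_nonneg _
  · filter_upwards [eventually_oddFactorial_pos h.tendsto_card (Fintype.card I + (l + 1))] with n hn
    have hT : (0 : ℝ) < (pairingsContaining (∅ : Finset (Sym2 (H n)))).card :=
      Nat.cast_pos.2 (hne n).card_pos
    have hO : (0 : ℝ) < oddFactorial (Fintype.card (H n)) (Fintype.card I + (l + 1)) :=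
      Nat.cast_pos.2 hn
    rw [pairingAverage, finAverage, div_le_div_iff₀ hT hO]
    exact_mod_cast sum_card_earedCircuits_le (p n) σ l

variable {ι : Type*} [Fintype ι] {k : ι → ℕ}

/-- The joint factorial moments of the numbers of isolated cycles. -/
theorem SparseRegime.tendsto_factorial_moments (h : SparseRegime p Δ ν)
    (hne : ∀ n, (pairingsContaining (∅ : Finset (Sym2 (H n)))).Nonempty) (hk : ∀ i, 1 ≤ k i)
    (hk' : Function.Injective k) (r : ι → ℕ) :
    Tendsto (fun n => pairingAverage fun M =>
        ∏ i, ((isolatedSets (p n) M k i).card.descFactorial (r i) : ℝ)) atTop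
      (nhds (∏ i, (ν ^ k i / (2 * k i)) ^ r i)) := by
  set C : ℝ := ∏ i, (2 * (k i : ℝ)) ^ r i with hC
  have hCpos : 0 < C := Finset.prod_pos fun i _ => by
    have : (0 : ℝ) < k i := Nat.cast_pos.2 (hk i)
    positivity
  have hmain : Tendsto (fun n => C * pairingAverage fun M =>
      ∏ i, ((isolatedSets (p n) M k i).card.descFactorial (r i) : ℝ)) atTop
      (nhds (ν ^ Fintype.card (FamilyIndex k r))) := by
    have hD := h.tendsto_average_disjointCircuits hne (familyRotate k r)
    have hE : Tendsto (fun n => ∑ l ∈ Finset.range (∑ i, k i), pairingAverage fun M =>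
        ((earedCircuits (p n) M (familyRotate k r) l).card : ℝ)) atTop (nhds 0) := by
      simpa using tendsto_finsetSum (Finset.range (∑ i, k i)) fun l _ =>
        h.tendsto_average_earedCircuits hne (familyRotate k r) l
    have hDE := hD.sub hE
    rw [sub_zero] at hDE
    refine tendsto_of_tendsto_of_tendsto_of_le_of_le hDE hD (fun n => ?_) fun n => ?_
    · simp only [pairingAverage]
      rw [← finAverage_sum, ← finAverage_sub, ← finAverage_const_mul]
      refine finAverage_mono fun M _ => ?_
      rw [sub_le_iff_le_add, hC, ← Finset.prod_mul_distrib]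
      exact_mod_cast card_disjointCircuits_le (p n) M hk r
    · simp only [pairingAverage]
      rw [← finAverage_const_mul]
      refine finAverage_mono fun M _ => ?_
      rw [hC, ← Finset.prod_mul_distrib]
      exact_mod_cast prod_descFactorial_le (p n) M hk hk' r
  have hfin := hmain.const_mul C⁻¹
  simp only [inv_mul_cancel_left₀ hCpos.ne'] at hfin
  convert hfin using 2
  rw [card_familyIndex, ← Finset.prod_pow_eq_pow_sum, hC, ← Finset.prod_inv_distrib,
    ← Finset.prod_mul_distrib]
  refine Finset.prod_congr rfl fun i _ => ?_
  rw [div_pow, ← pow_mul, mul_comm (k i), inv_mul_eq_div]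

-- First-moment bound: a non-isolated cycle forces an eared cycle, so the indicator is at most the
-- total number of these.
open Classical in
theorem SparseRegime.tendsto_average_not_isolated (h : SparseRegime p Δ ν)
    (hne : ∀ n, (pairingsContaining (∅ : Finset (Sym2 (H n)))).Nonempty) (k : ι → ℕ) :
    Tendsto (fun n => pairingAverage fun M => if ∃ i, isolatedSets (p n) M k i ≠
      cycleSets (p n) M (k i) then 1 else 0) atTop (nhds 0) := by
  have hE : Tendsto (fun n => ∑ i, ∑ l ∈ Finset.range (∑ i, k i), pairingAverage fun M =>
      ((earedCircuits (p n) M (finRotate (k i)) l).card : ℝ)) atTop (nhds 0) := by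
    have := tendsto_finsetSum Finset.univ fun i _ => tendsto_finsetSum (Finset.range (∑ i, k i))
      fun l _ => h.tendsto_average_earedCircuits hne (finRotate (k i)) l
    simpa using this
  refine tendsto_of_tendsto_of_tendsto_of_le_of_le tendsto_const_nhds hE (fun n => ?_) fun n => ?_
  · exact finAverage_nonneg fun _ _ => by positivity
  · simp only [pairingAverage]
    simp only [← finAverage_sum]
    refine finAverage_mono fun M _ => ?_
    split_ifs with hM
    · obtain ⟨i, hi⟩ := hM
      obtain ⟨l, hl, hcard⟩ := exists_earedCircuits_nonempty hi
      calc (1 : ℝ) ≤ ((earedCircuits (p n) M (finRotate (k i)) l).card : ℝ) := by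
            exact_mod_cast hcard.card_pos
        _ ≤ ∑ l ∈ Finset.range (∑ i, k i),
              ((earedCircuits (p n) M (finRotate (k i)) l).card : ℝ) :=
            Finset.single_le_sum (f := fun l =>
              ((earedCircuits (p n) M (finRotate (k i)) l).card : ℝ))
              (fun _ _ => Nat.cast_nonneg _) (Finset.mem_range.2 hl)
        _ ≤ _ := Finset.single_le_sum (f := fun i => ∑ l ∈ Finset.range (∑ i, k i),
              ((earedCircuits (p n) M (finRotate (k i)) l).card : ℝ))
              (fun _ _ => Finset.sum_nonneg fun _ _ => Nat.cast_nonneg _) (Finset.mem_univ i)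
    · exact Finset.sum_nonneg fun _ _ => Finset.sum_nonneg fun _ _ => Nat.cast_nonneg _

open Classical in
/-- The joint distribution of the numbers of cycles converges to a product of Poisson
distributions. -/
theorem SparseRegime.tendsto_average_cycleSets (h : SparseRegime p Δ ν)
    (hne : ∀ n, (pairingsContaining (∅ : Finset (Sym2 (H n)))).Nonempty) (hk : ∀ i, 1 ≤ k i)
    (hk' : Function.Injective k) (j : ι → ℕ) :
    Tendsto (fun n => pairingAverage fun M =>
        if (fun i => (cycleSets (p n) M (k i)).card) = j then 1 else 0) atTop
      (nhds (∏ i, (Real.exp (-(ν ^ k i / (2 * k i))) * (ν ^ k i / (2 * k i)) ^ j i /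
        (j i).factorial))) := by
  have h1 := tendsto_finAverage_of_tendsto_factorial_moments hne
    (X := fun n M i => (isolatedSets (p n) M k i).card)
    (fun r => h.tendsto_factorial_moments hne hk hk' r) j
  have h2 := h.tendsto_average_not_isolated hne k
  rw [← add_zero (∏ i, _)]
  have hdiff : Tendsto (fun n => (pairingAverage fun M =>
      if (fun i => (cycleSets (p n) M (k i)).card) = j then 1 else 0) -
      finAverage (pairingsContaining (∅ : Finset (Sym2 (H n)))) fun M =>
        if (fun i => (isolatedSets (p n) M k i).card) = j then 1 else 0) atTop (nhds 0) := by
    -- The two indicators can differ only for matchings with a non-isolated cycle.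
    refine squeeze_zero_norm (fun n => ?_) h2
    rw [pairingAverage, ← finAverage_sub, Real.norm_eq_abs]
    refine (abs_finAverage_le _ _).trans (finAverage_mono fun M _ => ?_)
    by_cases hM : ∃ i, isolatedSets (p n) M k i ≠ cycleSets (p n) M (k i)
    · rw [if_pos hM]
      split_ifs <;> simp
    · rw [if_neg hM]
      push Not at hM
      simp [hM]
  exact (h1.add hdiff).congr fun n => by ring

end Asymptotics

theorem integral_uniformOn_univ {Ω : Type*} [Fintype Ω] [MeasurableSpace Ω]
    [MeasurableSingletonClass Ω] [Nonempty Ω] (f : Ω → ℝ) :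
    ∫ ω, f ω ∂(uniformOn (Set.univ : Set Ω)) = (∑ ω, f ω) / Fintype.card Ω := by
  have : IsProbabilityMeasure (uniformOn (Set.univ : Set Ω)) :=
    isProbabilityMeasure_uniformOn Set.finite_univ Set.univ_nonempty
  rw [integral_fintype Integrable.of_finite, Finset.sum_div]
  refine Finset.sum_congr rfl fun ω _ => ?_
  rw [measureReal_def, uniformOn_univ, Measure.count_singleton]
  simp [div_eq_inv_mul]

/-! ### Degree sums, passages and the maximal degree. -/

namespace DegreeSequence

variable {n : ℕ} (d : DegreeSequence n)

/-- The largest degree. -/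
def maxDeg : ℕ := Finset.univ.sup d.deg

theorem card_halfEdge : Fintype.card d.HalfEdge = ∑ i, d.deg i := by
  simp

theorem card_halfEdge_fibre (v : Fin n) :
    Nat.card {h : d.HalfEdge // h.1 = v} = d.deg v := by
  rw [Nat.card_congr (Equiv.sigmaSubtype v), Nat.card_eq_fintype_card, Fintype.card_fin]

theorem card_transit :
    (Nat.card (Transit (Sigma.fst : d.HalfEdge → Fin n)) : ℝ) =
      ∑ i, (d.deg i : ℝ) ^ 2 - ∑ i, (d.deg i : ℝ) := by
  let F : (Σ v : Fin n, {x : Fin (d.deg v) × Fin (d.deg v) // x.1 ≠ x.2}) →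
      Transit (Sigma.fst : d.HalfEdge → Fin n) := fun t =>
    ⟨(⟨t.1, t.2.1.1⟩, ⟨t.1, t.2.1.2⟩), fun h => t.2.2 (by simpa using h), rfl⟩
  have hF : Function.Bijective F := by
    constructor
    · rintro ⟨v, ⟨a, b⟩, h⟩ ⟨v', ⟨a', b'⟩, h'⟩ heq
      have h1 := congrArg (fun t => t.1.1) heq
      have h2 := congrArg (fun t => t.1.2) heq
      simp only [F, Sigma.mk.injEq] at h1 h2
      obtain ⟨rfl, h1⟩ := h1
      rw [heq_eq_eq] at h1
      have h2 := eq_of_heq h2.2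
      subst h1 h2
      rfl
    · rintro ⟨⟨⟨v, a⟩, ⟨w, b⟩⟩, hne, hv⟩
      have hv : v = w := hv
      subst hv
      exact ⟨⟨v, (a, b), fun h => hne (by simpa using h)⟩, rfl⟩
  rw [← Nat.card_eq_of_bijective F hF, Nat.card_eq_fintype_card, Fintype.card_sigma,
    ← Finset.sum_sub_distrib, Nat.cast_sum]
  refine Finset.sum_congr rfl fun v _ => ?_
  have : (Finset.univ.filter fun x : Fin (d.deg v) × Fin (d.deg v) => x.1 ≠ x.2) =
      (Finset.univ : Finset (Fin (d.deg v))).offDiag := by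
    ext x; simp
  rw [Fintype.card_subtype, this, Finset.offDiag_card, Finset.card_univ, Fintype.card_fin,
    Nat.cast_sub (Nat.le_mul_self _), Nat.cast_mul, sq]

/-- If the maximal degree exceeds `K`, its square is one of the terms of the tail sum. -/
theorem maxDeg_sq_le (K : ℕ) :
    (d.maxDeg : ℝ) ^ 2 ≤ (K : ℝ) ^ 2 +
      (∑ i, (d.deg i : ℝ) ^ 2 - ∑ i, if d.deg i ≤ K then (d.deg i : ℝ) ^ 2 else 0) := by
  have hterm : ∀ i, 0 ≤ (d.deg i : ℝ) ^ 2 - if d.deg i ≤ K then (d.deg i : ℝ) ^ 2 else 0 := by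
    intro i
    split_ifs
    · simp
    · simp
  rw [← Finset.sum_sub_distrib]
  have hsum := Finset.sum_nonneg fun i (_ : i ∈ Finset.univ) => hterm i
  rcases le_or_gt d.maxDeg K with h | h
  · have : (d.maxDeg : ℝ) ^ 2 ≤ (K : ℝ) ^ 2 := by gcongr
    linarith
  · obtain ⟨i, -, hi⟩ : ∃ i ∈ Finset.univ, K < d.deg i := Finset.lt_sup_iff.1 h
    obtain ⟨j, -, hj⟩ := Finset.exists_mem_eq_sup Finset.univ ⟨i, Finset.mem_univ i⟩ d.deg
    have hj : d.maxDeg = d.deg j := hj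
    have := Finset.single_le_sum (f := fun i => (d.deg i : ℝ) ^ 2 -
      if d.deg i ≤ K then (d.deg i : ℝ) ^ 2 else 0) (fun i _ => hterm i) (Finset.mem_univ j)
    rw [if_neg (by omega), sub_zero] at this
    rw [hj]
    have hK : 0 ≤ (K : ℝ) ^ 2 := by positivity
    linarith

end DegreeSequence

/-! ### The regularity assumption yields the sparse regime. -/

namespace HasLimitDegreeDistribution

variable {d : (n : ℕ) → DegreeSequence n} {D : Measure ℕ} [IsProbabilityMeasure D]

theorem tendsto_sum_div (hd : HasLimitDegreeDistribution d D) :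
    Tendsto (fun n => (∑ i, ((d (n + 1)).deg i : ℝ)) / ((n + 1 : ℕ) : ℝ)) atTop
      (nhds (∫ k, (k : ℝ) ∂D)) := by
  refine hd.tendsto_fst_moment.congr fun n => ?_
  rw [integral_uniformOn_univ, Fintype.card_fin]

theorem tendsto_sum_sq_div (hd : HasLimitDegreeDistribution d D) :
    Tendsto (fun n => (∑ i, ((d (n + 1)).deg i : ℝ) ^ 2) / ((n + 1 : ℕ) : ℝ)) atTop
      (nhds (∫ k, (k : ℝ) ^ 2 ∂D)) := by
  refine hd.tendsto_snd_moment.congr fun n => ?_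
  rw [integral_uniformOn_univ, Fintype.card_fin]

/-- The truncated square is bounded, and continuous on the discrete space ℕ, so weak convergence
applies to it. -/
theorem tendsto_sum_truncated_div (hd : HasLimitDegreeDistribution d D) (K : ℕ) :
    Tendsto (fun n => (∑ i, if (d (n + 1)).deg i ≤ K then ((d (n + 1)).deg i : ℝ) ^ 2 else 0) /
      ((n + 1 : ℕ) : ℝ)) atTop (nhds (∫ k, (if k ≤ K then (k : ℝ) ^ 2 else 0) ∂D)) := by
  let f : BoundedContinuousFunction ℕ ℝ := BoundedContinuousFunction.ofNormedAddCommGroupDiscrete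
    (fun k => if k ≤ K then (k : ℝ) ^ 2 else 0) ((K : ℝ) ^ 2) (fun k => by
      split_ifs with h
      · rw [Real.norm_eq_abs, abs_of_nonneg (by positivity)]
        gcongr
      · simp)
  have h := (ProbabilityMeasure.tendsto_iff_forall_integral_tendsto.1
    hd.tendsto_distribution.tendsto) f
  have hlim : ∫ k, f k ∂(D.map id) = ∫ k, (if k ≤ K then (k : ℝ) ^ 2 else 0) ∂D := by
    rw [Measure.map_id]
    rfl
  refine (h.congr fun n => ?_).trans_eq (congrArg nhds hlim)
  change ∫ k, f k ∂((uniformOn (Set.univ : Set (Fin (n + 1)))).map (d (n + 1)).deg) = _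
  rw [integral_map (Measurable.of_discrete).aemeasurable
    (f.continuous.aestronglyMeasurable), integral_uniformOn_univ, Fintype.card_fin]
  rfl

theorem tendsto_truncated (hd : HasLimitDegreeDistribution d D) :
    Tendsto (fun K : ℕ => ∫ k, (if k ≤ K then (k : ℝ) ^ 2 else 0) ∂D) atTop
      (nhds (∫ k, (k : ℝ) ^ 2 ∂D)) := by
  refine tendsto_integral_of_dominated_convergence (fun k => (k : ℝ) ^ 2)
    (fun K => (Measurable.of_discrete).aestronglyMeasurable) hd.integrable_snd
    (fun K => Eventually.of_forall fun k => ?_) (Eventually.of_forall fun k => ?_)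
  · split_ifs
    · rw [Real.norm_eq_abs, abs_of_nonneg (by positivity)]
    · simp
  · refine tendsto_const_nhds.congr' ?_
    filter_upwards [eventually_ge_atTop k] with K hK
    rw [if_pos hK]

/-- Uniform integrability of the squared degrees: the maximal square is at most `K ^ 2` plus the
tail beyond `K`. Divided by the number of vertices, the first part vanishes for fixed `K`, and the
tail converges to that of E[D²], which is small for large `K`. -/
theorem tendsto_maxDeg_sq_div (hd : HasLimitDegreeDistribution d D) :
    Tendsto (fun n => ((d (n + 1)).maxDeg : ℝ) ^ 2 / ((n + 1 : ℕ) : ℝ)) atTop (nhds 0) := by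
  refine tendsto_of_approx (u := fun _ _ => 0) (U := fun _ => 0)
    (v := fun K n => (K : ℝ) ^ 2 / ((n + 1 : ℕ) : ℝ) +
      ((∑ i, ((d (n + 1)).deg i : ℝ) ^ 2) / ((n + 1 : ℕ) : ℝ) -
      (∑ i, if (d (n + 1)).deg i ≤ K then ((d (n + 1)).deg i : ℝ) ^ 2 else 0) /
      ((n + 1 : ℕ) : ℝ)))
    (W := fun K => 0 + (∫ k, (k : ℝ) ^ 2 ∂D - ∫ k, (if k ≤ K then (k : ℝ) ^ 2 else 0) ∂D))
    (fun _ => tendsto_const_nhds) (fun K => ?_) (fun K n => ?_) tendsto_const_nhds ?_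
  · exact ((tendsto_const_div_atTop_nhds_zero_nat _).comp (tendsto_add_atTop_nat 1)).add
      (hd.tendsto_sum_sq_div.sub (hd.tendsto_sum_truncated_div K))
  · rw [sub_zero, abs_of_nonneg (by positivity), ← sub_div, ← add_div]
    gcongr
    exact (d (n + 1)).maxDeg_sq_le K
  · have h := hd.tendsto_truncated.const_sub (∫ k, (k : ℝ) ^ 2 ∂D)
    rw [sub_self] at h
    simpa only [zero_add] using h

theorem nuParameter_eq (hd : HasLimitDegreeDistribution d D) :
    nuParameter D = (∫ k, (k : ℝ) ^ 2 ∂D - ∫ k, (k : ℝ) ∂D) / ∫ k, (k : ℝ) ∂D := by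
  rw [nuParameter, ← integral_sub hd.integrable_snd hd.integrable_fst]
  congr 2
  funext k
  ring

theorem sparseRegime (hd : HasLimitDegreeDistribution d D) (hpos : 0 < ∫ k, (k : ℝ) ∂D) :
    SparseRegime (fun n => (Sigma.fst : (d n).HalfEdge → Fin n)) (fun n => (d n).maxDeg)
      (nuParameter D) := by
  have hcard : ∀ n, (Fintype.card (d n).HalfEdge : ℝ) = ∑ i, ((d n).deg i : ℝ) := fun n => by
    rw [(d n).card_halfEdge, Nat.cast_sum]
  have hN : ∀ n : ℕ, ((n + 1 : ℕ) : ℝ) ≠ 0 := fun n => Nat.cast_ne_zero.2 n.succ_ne_zero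
  refine ⟨fun n v => ?_, ?_, ?_, ?_⟩
  · rw [(d n).card_halfEdge_fibre]
    exact Finset.le_sup (Finset.mem_univ v)
  · rw [← tendsto_natCast_atTop_iff (R := ℝ), ← tendsto_add_atTop_iff_nat 1]
    have h := hd.tendsto_sum_div.pos_mul_atTop hpos
      ((tendsto_natCast_atTop_atTop (R := ℝ)).comp (tendsto_add_atTop_nat 1))
    refine h.congr fun n => ?_
    rw [hcard, Function.comp_apply, div_mul_cancel₀ _ (hN n)]
  · rw [← tendsto_add_atTop_iff_nat 1, hd.nuParameter_eq]
    refine ((hd.tendsto_sum_sq_div.sub hd.tendsto_sum_div).div hd.tendsto_sum_div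
      hpos.ne').congr fun n => ?_
    rw [hcard, (d (n + 1)).card_transit]
    simp only [Pi.div_apply]
    rw [← sub_div, div_div_div_cancel_right₀ (hN n)]
  · rw [← tendsto_add_atTop_iff_nat 1]
    have h := hd.tendsto_maxDeg_sq_div.div hd.tendsto_sum_div hpos.ne'
    rw [zero_div] at h
    refine h.congr fun n => ?_
    rw [hcard]
    simp only [Pi.div_apply]
    rw [div_div_div_cancel_right₀ (hN n)]

/-- A vanishing mean makes `D` almost surely zero, and `countDeg_eq_zero` then forbids every
positive degree for every `n`, not just in the limit. -/
theorem deg_eq_zero (hd : HasLimitDegreeDistribution d D) (h0 : ∫ k, (k : ℝ) ∂D = 0) (n : ℕ)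
    (i : Fin n) : (d n).deg i = 0 := by
  by_contra hne
  have hae := (integral_eq_zero_iff_of_nonneg (fun k => Nat.cast_nonneg k) hd.integrable_fst).1 h0
  have hD : D {(d n).deg i} = 0 := by
    refine measure_mono_null ?_ (ae_iff.1 hae)
    rintro _ rfl
    simpa using hne
  have := hd.countDeg_eq_zero _ hD n
  rw [DegreeSequence.countDeg, Finset.card_eq_zero] at this
  exact Finset.notMem_empty i (this ▸ Finset.mem_filter.2 ⟨Finset.mem_univ i, rfl⟩)

end HasLimitDegreeDistribution

/-- On a countable space, convergence of the probability mass functions to that of a probability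
measure implies convergence in distribution. -/
theorem tendstoInDistribution_of_tendsto_singleton {E : Type*} [Countable E] [TopologicalSpace E]
    [MeasurableSpace E] [OpensMeasurableSpace E] [MeasurableSingletonClass E] {Ω : ℕ → Type*}
    [∀ n, MeasurableSpace (Ω n)] {X : ∀ n, Ω n → E} (hX : ∀ n, Measurable (X n))
    {P : ∀ n, Measure (Ω n)} [∀ n, IsProbabilityMeasure (P n)] {Q : Measure E}
    [IsProbabilityMeasure Q]
    (h : ∀ j, Tendsto (fun n => (P n).real {ω | X n ω = j}) atTop (nhds (Q.real {j}))) :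
    TendstoInDistribution X atTop id P Q := by
  classical
  refine ⟨fun n => (hX n).aemeasurable, aemeasurable_id, ?_⟩
  have hmap : ∀ n j, (P n).map (X n) {j} = P n {ω | X n ω = j} := fun n j =>
    Measure.map_apply (hX n) (measurableSet_singleton j)
  have h' : ∀ j, Tendsto (fun n => (P n).map (X n) {j}) atTop (nhds (Q.map id {j})) := by
    intro j
    simp only [hmap, Measure.map_id]
    exact (ENNReal.tendsto_toReal_iff (fun n => measure_ne_top _ _) (measure_ne_top _ _)).1 (h j)
  -- Portmanteau criterion for open sets: a finite part of `G` already has mass above `c`, and on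
  -- finite sets pointwise convergence suffices.
  refine tendsto_of_forall_isOpen_le_liminf fun G hG => le_of_forall_lt fun c hc => ?_
  have hc' : (c : ENNReal) < Q.map id G := (ENNReal.coe_lt_coe.2 hc).trans_eq
    (ProbabilityMeasure.ennreal_coeFn_eq_coeFn_toMeasure _ G)
  rw [← Measure.tsum_indicator_apply_singleton _ G hG.measurableSet,
    ENNReal.tsum_eq_iSup_sum] at hc'
  obtain ⟨F, hF⟩ := lt_iSup_iff.1 hc'
  obtain ⟨b, hcb, hbF⟩ := ENNReal.lt_iff_exists_nnreal_btwn.1 hF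
  have hlim : Tendsto (fun n => ∑ x ∈ F, G.indicator (fun x => (P n).map (X n) {x}) x) atTop
      (nhds (∑ x ∈ F, G.indicator (fun x => Q.map id {x}) x)) := by
    refine tendsto_finsetSum _ fun x _ => ?_
    by_cases hx : x ∈ G
    · simpa only [Set.indicator_of_mem hx] using h' x
    · simpa only [Set.indicator_of_notMem hx] using tendsto_const_nhds
  refine (ENNReal.coe_lt_coe.1 hcb).trans_le (le_liminf_of_le ?_ ?_)
  · exact (isBoundedUnder_of ⟨1, fun n => ProbabilityMeasure.apply_le_one _ _⟩).isCoboundedUnder_ge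
  · filter_upwards [hlim.eventually (lt_mem_nhds hbF)] with n hn
    refine ENNReal.coe_le_coe.1 (le_trans ?_
      (ProbabilityMeasure.ennreal_coeFn_eq_coeFn_toMeasure _ G).ge)
    refine hn.le.trans ((ENNReal.sum_le_tsum F).trans_eq ?_)
    exact Measure.tsum_indicator_apply_singleton _ G hG.measurableSet

/-! ### Averages over matchings as probabilities in the configuration model. -/

namespace DegreeSequence

variable {n : ℕ} (d : DegreeSequence n)

theorem pairingsContaining_empty_nonempty :
    (pairingsContaining (∅ : Finset (Sym2 d.HalfEdge))).Nonempty := by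
  obtain ⟨M⟩ := (inferInstance : Nonempty d.Configuration)
  exact ⟨M.1, mem_pairingsContaining.2 ⟨M.2, Finset.empty_subset _⟩⟩

theorem configurationModel_real_eq_pairingAverage (A : Finset (Sym2 d.HalfEdge) → Prop)
    [DecidablePred A] :
    d.configurationModel.real {M | A M.1} = pairingAverage fun M => if A M then 1 else 0 := by
  let _ : Fintype d.Configuration := Fintype.ofFinite _
  have hsum : ∀ f : Finset (Sym2 d.HalfEdge) → ℝ,
      ∑ M ∈ pairingsContaining (∅ : Finset (Sym2 d.HalfEdge)), f M =
        ∑ M : d.Configuration, f M.1 := by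
    intro f
    refine (Finset.sum_bij (fun (M : d.Configuration) _ => M.1) ?_ ?_ ?_ ?_).symm
    · exact fun M _ => mem_pairingsContaining.2 ⟨M.2, Finset.empty_subset _⟩
    · exact fun M _ N _ h => Subtype.ext h
    · exact fun M hM => ⟨⟨M, (mem_pairingsContaining.1 hM).1⟩, Finset.mem_univ _, rfl⟩
    · exact fun _ _ => rfl
  have hcard : ((pairingsContaining (∅ : Finset (Sym2 d.HalfEdge))).card : ℝ) =
      Fintype.card d.Configuration := by
    simpa using hsum fun _ => 1
  rw [pairingAverage, finAverage, hsum, hcard, ← integral_uniformOn_univ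
    (fun M : d.Configuration => if A M.1 then (1 : ℝ) else 0),
    ← integral_indicator_one (MeasurableSet.of_discrete)]
  refine integral_congr_ae (Eventually.of_forall fun M => ?_)
  simp [Set.indicator_apply]

end DegreeSequence

/-! ### The Poisson limit and the probability of simplicity. -/

section PoissonLimit

variable {d : (n : ℕ) → DegreeSequence n} {D : Measure ℕ} [IsProbabilityMeasure D]

theorem HasLimitDegreeDistribution.tendsto_cycleCount (hd : HasLimitDegreeDistribution d D)
    {ι : Type*} [Fintype ι] {k : ι → ℕ} (hk' : Function.Injective k) (hk : ∀ i, 1 ≤ k i)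
    (j : ι → ℕ) :
    Tendsto (fun n => (d n).configurationModel.real
        {M | (fun i => M.multigraph.cycleCount (k i)) = j}) atTop
      (nhds (∏ i, (Real.exp (-(nuParameter D ^ k i / (2 * k i))) *
        (nuParameter D ^ k i / (2 * k i)) ^ j i / (j i).factorial))) := by
  classical
  have hreal : ∀ n, (d n).configurationModel.real
      {M | (fun i => M.multigraph.cycleCount (k i)) = j} = pairingAverage fun M =>
        if (fun i => (cycleSets (Sigma.fst : (d n).HalfEdge → Fin n) M (k i)).card) = j
          then 1 else 0 := by
    intro n
    rw [← DegreeSequence.configurationModel_real_eq_pairingAverage]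
    simp only [DegreeSequence.Configuration.cycleCount_eq_card]
  simp only [hreal]
  have hnonneg : 0 ≤ ∫ k, (k : ℝ) ∂D := integral_nonneg fun k => Nat.cast_nonneg k
  -- If E[D] = 0 there are no half-edges, hence no cycles. The limit is the unit mass at 0, which is
  -- also the Poisson product since ν = 0 and every length is at least 1.
  rcases hnonneg.eq_or_lt with h0 | hpos
  · have hν : nuParameter D = 0 := by rw [nuParameter, ← h0, div_zero]
    have hempty : ∀ n (M : Finset (Sym2 (d n).HalfEdge)) i,
        cycleSets (Sigma.fst : (d n).HalfEdge → Fin n) M (k i) = ∅ := by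
      intro n M i
      refine Finset.eq_empty_of_forall_notMem fun E hE => ?_
      obtain ⟨-, c, -⟩ := mem_cycleSets.1 hE
      have h := (c ⟨0, hk i⟩).inn
      exact absurd (h.2.isLt.trans_eq (hd.deg_eq_zero h0.symm n h.1)) (Nat.not_lt_zero _)
    simp only [hempty, Finset.card_empty, pairingAverage,
      finAverage_const ((d _).pairingsContaining_empty_nonempty)]
    refine tendsto_const_nhds.congr fun n => ?_
    rw [hν]
    have hz : ∀ i, (0 : ℝ) ^ k i / (2 * k i) = 0 := fun i => by
      rw [zero_pow (Nat.one_le_iff_ne_zero.1 (hk i)), zero_div]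
    simp only [hz, neg_zero, Real.exp_zero, one_mul]
    split_ifs with hj
    · subst hj
      simp
    · obtain ⟨i, hi⟩ := Function.ne_iff.1 hj
      exact Finset.prod_eq_zero (Finset.mem_univ i) (by rw [zero_pow (Ne.symm hi), zero_div])
  · exact (hd.sparseRegime hpos).tendsto_average_cycleSets
      (fun n => (d n).pairingsContaining_empty_nonempty) hk hk' j

theorem nuParameter_nonneg (D : Measure ℕ) : 0 ≤ nuParameter D := by
  refine div_nonneg (integral_nonneg fun k => ?_) (integral_nonneg fun k => Nat.cast_nonneg k)
  rcases k with _ | k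
  · simp
  · simp only [Pi.zero_apply]
    push_cast
    have : (0 : ℝ) ≤ k := Nat.cast_nonneg k
    nlinarith

end PoissonLimit

theorem mainTheorem8 (d : (n : ℕ) → DegreeSequence n) (D : Measure ℕ) [IsProbabilityMeasure D]
    (hd : HasLimitDegreeDistribution d D) :
    (∀ (l : ℕ) (k : Fin l → ℕ), Function.Injective k → (∀ i, 1 ≤ k i) →
      TendstoInDistribution
        (fun n (M : (d n).Configuration) (i : Fin l) => M.multigraph.cycleCount (k i)) atTop id
        (fun n => (d n).configurationModel)
        (Measure.pi fun i => poissonMeasure (nuParameter D ^ k i / (2 * k i)).toNNReal)) ∧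
    Tendsto (fun n => (d n).configurationModel.real {M | M.multigraph.Simple}) atTop
      (nhds (Real.exp (-nuParameter D / 2 - nuParameter D ^ 2 / 4))) := by
  constructor
  · intro l k hk' hk
    refine tendstoInDistribution_of_tendsto_singleton (fun n => Measurable.of_discrete) fun j => ?_
    have hQ : (Measure.pi fun i =>
        poissonMeasure (nuParameter D ^ k i / (2 * k i)).toNNReal).real {j} =
        ∏ i, (Real.exp (-(nuParameter D ^ k i / (2 * k i))) *
          (nuParameter D ^ k i / (2 * k i)) ^ j i / (j i).factorial) := by
      rw [measureReal_def, Measure.pi_singleton, ENNReal.toReal_prod]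
      refine Finset.prod_congr rfl fun i _ => ?_
      have := nuParameter_nonneg D
      rw [← measureReal_def, poissonMeasure_real_singleton, Real.coe_toNNReal _ (by positivity)]
    rw [hQ]
    exact hd.tendsto_cycleCount hk' hk j
  -- The limiting probability of no loops and no pairs of parallel edges is the product of the
  -- Poisson masses at 0 for means ν/2 and ν²/4.
  · have h := hd.tendsto_cycleCount (k := ![1, 2]) (by decide) (by decide) 0
    refine (h.congr fun n => ?_).trans_eq ?_
    · congr 1
      ext M
      simp [DegreeSequence.Configuration.simple_iff, funext_iff, Fin.forall_fin_two]
    · congr 1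
      rw [Fin.prod_univ_two]
      simp only [Matrix.cons_val_zero, Matrix.cons_val_one, Pi.zero_apply, pow_zero, mul_one,
        Nat.factorial_zero, Nat.cast_one, div_one, ← Real.exp_add]
      congr 1
      push_cast
      ring
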